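/- Let $\Bbbk$ be a field. A *commutative tri-algebra* is a $\Bbbk$-vector space $A$ with bilinear operations $\ast,\bullet$ such that $(x\ast y)\ast z=x\ast(y\ast z)=x\ast(z\ast y)$, $x\bullet y=y\bullet x$, $(x\bullet y)\bullet z=x\bullet(y\bullet z)$, $x\ast(y\bullet z)=x\ast(y\ast z)$ and $(x\bullet y)\ast z=x\bullet(y\ast z)$. A *tri-dendriform algebra* is a $\Bbbk$-vector space $B$ with bilinear operations $\prec,\succ,\cdot$ such that, with $x\circ y:=x\prec y+x\succ y+x\cdot y$, $(x\prec y)\prec z=x\prec(y\circ z)$, $(x\succ y)\prec z=x\succ(y\prec z)$, $(x\circ y)\succ z=x\succ(y\succ z)$, $x\succ(y\cdot z)=(x\succ y)\cdot z$, $(x\prec y)\cdot z=x\cdot(y\succ z)$, $(x\cdot y)\prec z=x\cdot(y\prec z)$, $(x\cdot y)\cdot z=x\cdot(y\cdot z)$. A *$B$-module* is a vector space $N$ with bilinear operations $\prec,\succ,\cdot$ both $B\times N\to N$ and $N\times B\to N$, such that these seven identities hold whenever exactly one of $x,y,z$ lies in $N$ and the other two lie in $B$. For $n\ge 0$ let $C^n_{\mathrm{tri}}(B,N)$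 be the space of families $g=(g(I;\,\cdot\,))_I$ of $n$-linear maps $B^n\to N$ indexed by the non-empty subsets $I\subseteq\{1,\dots,n\}$ (so $C^0_{\mathrm{tri}}(B,N)=0$), and define $\delta_{\mathrm{tri}}:C^n_{\mathrm{tri}}(B,N)\to C^{n+1}_{\mathrm{tri}}(B,N)$ by $$(\delta_{\mathrm{tri}}g)(I;b_1,\dots,b_{n+1})=L_I+\sum_{i=1}^n(-1)^i\,g\big(\sigma_i(I);b_1,\dots,b_i\circ_{i,I}b_{i+1},\dots,b_{n+1}\big)+(-1)^{n+1}R_I .$$ Here $\sigma_i:\{1,\dots,n+1\}\to\{1,\dots,n\}$ is $\sigma_i(j)=j$ for $j\le i$ and $\sigma_i(j)=j-1$ for $j>i$; the operation $\circ_{i,I}$ is $\prec$, $\succ$, $\cdot$ or $\circ$ according as $I\cap\{i,i+1\}$ is $\{i\}$, $\{i+1\}$, $\{i,i+1\}$ or $\emptyset$. With $I'=\{j\in\{1,\dots,n\}: j+1\in I\}$, $L_I$ is $b_1\cdot g(I';b_2,\dots,b_{n+1})$ if $\{1\}\subsetneq I$, $b_1\succ g(I';b_2,\dots,b_{n+1})$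 if $1\notin I$, and $\sum_J b_1\prec g(J;b_2,\dots,b_{n+1})$ if $I=\{1\}$. With $I''=I\cap\{1,\dots,n\}$, $R_I$ is $g(I'';b_1,\dots,b_n)\cdot b_{n+1}$ if $\{n+1\}\subsetneq I$, $g(I'';b_1,\dots,b_n)\prec b_{n+1}$ if $n+1\notin I$, and $\sum_J g(J;b_1,\dots,b_n)\succ b_{n+1}$ if $I=\{n+1\}$. The sums over $J$ run over all non-empty subsets of $\{1,\dots,n\}$. **Theorem.** Let $A$ be the free commutative tri-algebra on a non-empty set, $B$ a tri-dendriform algebra and $N$ a $B$-module, all over $\Bbbk$. Then the product $$(a_1\otimes b_1)(a_2\otimes b_2)=(a_1\ast a_2)\otimes(b_1\prec b_2)+(a_2\ast a_1)\otimes(b_1\succ b_2)+(a_1\bullet a_2)\otimes(b_1\cdot b_2)$$ makes $A\otimes B$ an associative (not necessarily unital) algebra, and the same formula, with $b_2$ (respectively $b_1$) replaced by an element of $N$, makes $A\otimes N$ an $A\otimes B$-bimodule. Let $C^n_{\mathrm{Hoch}}(A\otimes B,A\otimes N)$ be the space of $n$-linear maps $(A\otimes B)^n\to A\otimes N$, $n\ge0$,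 with the Hochschild differential $$(\delta_{\mathrm{HH}}f)(x_1,\dots,x_{n+1})=x_1f(x_2,\dots,x_{n+1})+\sum_{i=1}^n(-1)^if(x_1,\dots,x_ix_{i+1},\dots,x_{n+1})+(-1)^{n+1}f(x_1,\dots,x_n)x_{n+1}.$$ Then $\delta_{\mathrm{tri}}^2=0$ and $\delta_{\mathrm{HH}}^2=0$, and there are linear maps $\Psi:C^n_{\mathrm{tri}}(B,N)\to C^n_{\mathrm{Hoch}}(A\otimes B,A\otimes N)$, $n\ge0$, given by $$(\Psi g)(a_1\otimes b_1,\dots,a_n\otimes b_n)=\sum_{\emptyset\ne I\subseteq\{1,\dots,n\}}P(a_1,\dots,a_n;I)\otimes g(I;b_1,\dots,b_n),$$ $$P(a_1,\dots,a_n;I)=(a_{i_1}\bullet\cdots\bullet a_{i_k})\ast(a_{j_1}\ast\cdots\ast a_{j_{n-k}}),$$ where $I=\{i_1<\dots<i_k\}$ and $\{1,\dots,n\}\setminus I=\{j_1<\dots<j_{n-k}\}$ (the second factor being omitted if $I=\{1,\dots,n\}$). They form an injective cochain map: every $\Psi:C^n_{\mathrm{tri}}(B,N)\to C^n_{\mathrm{Hoch}}(A\otimes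 B,A\otimes N)$ is injective and $\delta_{\mathrm{HH}}(\Psi g)=\Psi(\delta_{\mathrm{tri}}g)$ for all $g$. In particular $\Psi$ sends tri-dendriform cocycles to Hochschild cocycles and tri-dendriform coboundaries to Hochschild coboundaries, hence cocycle classes to cocycle classes. -/

import Mathlib

open scoped TensorProduct

/-! ### The three kinds of algebraic structure -/

/-- Commutative tri-algebras over a field: a Perm product `ast` (written `∗`) and a commutative
associative product `bul` (written `•`), with two compatibility relations. -/
class CommTriAlgebra (k : Type*) (A : Type*) [Field k] [AddCommGroup A] [Module k A] where
  ast : A →ₗ[k] A →ₗ[k] A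
  bul : A →ₗ[k] A →ₗ[k] A
  ast_assoc : ∀ x y z : A, ast (ast x y) z = ast x (ast y z)
  ast_perm : ∀ x y z : A, ast x (ast y z) = ast x (ast z y)
  bul_comm : ∀ x y : A, bul x y = bul y x
  bul_assoc : ∀ x y z : A, bul (bul x y) z = bul x (bul y z)
  ast_bul : ∀ x y z : A, ast x (bul y z) = ast x (ast y z)
  bul_ast : ∀ x y z : A, ast (bul x y) z = bul x (ast y z)

/-- `A` is a free commutative tri-algebra on the family `ι : X → A` of generators: every map from
`X` to a commutative tri-algebra `C` extends along `ι` to a unique homomorphism `A → C`. The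
universe of `C` is large enough to contain (copies of) `A` and of the algebra of terms in `X`. -/
def CommTriAlgebra.IsFree.{u, v, w} (k : Type u) {X : Type v} {A : Type w} [Field k]
    [AddCommGroup A] [Module k A] [CommTriAlgebra k A] (ι : X → A) : Prop :=
  ∀ (C : Type (max u v w)) [AddCommGroup C] [Module k C] [CommTriAlgebra k C] (f : X → C),
    ∃! φ : A →ₗ[k] C,
      (∀ x y : A, φ (ast (k := k) x y) = ast (k := k) (φ x) (φ y)) ∧
      (∀ x y : A, φ (bul (k := k) x y) = bul (k := k) (φ x) (φ y)) ∧
      ∀ x : X, φ (ι x) = f x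

/-- Tri-dendriform algebras over a field: three bilinear operations `prec` (`≺`), `succ` (`≻`),
`dot` (`·`) subject to seven identities. -/
class TriDendriform (k : Type*) (B : Type*) [Field k] [AddCommGroup B] [Module k B] where
  prec : B →ₗ[k] B →ₗ[k] B
  succ : B →ₗ[k] B →ₗ[k] B
  dot : B →ₗ[k] B →ₗ[k] B
  prec_prec : ∀ x y z : B, prec (prec x y) z = prec x (prec y z + succ y z + dot y z)
  succ_prec : ∀ x y z : B, prec (succ x y) z = succ x (prec y z)
  succ_succ : ∀ x y z : B, succ (prec x y + succ x y + dot x y) z = succ x (succ y z)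
  succ_dot : ∀ x y z : B, succ x (dot y z) = dot (succ x y) z
  prec_dot : ∀ x y z : B, dot (prec x y) z = dot x (succ y z)
  dot_prec : ∀ x y z : B, prec (dot x y) z = dot x (prec y z)
  dot_dot : ∀ x y z : B, dot (dot x y) z = dot x (dot y z)

/-- The total product `x ∘ y = x ≺ y + x ≻ y + x · y`. -/
def TriDendriform.total (k : Type*) (B : Type*) [Field k] [AddCommGroup B] [Module k B]
    [TriDendriform k B] : B →ₗ[k] B →ₗ[k] B :=
  prec + succ + dot

/-- Modules over a tri-dendriform algebra `B`: left operations `b ≺ n`, `b ≻ n`, `b · n` (`lprec`,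
`lsucc`, `ldot`) and right operations `n ≺ b`, `n ≻ b`, `n · b` (`rprec`, `rsucc`, `rdot`), such
that each of the seven tri-dendriform identities holds whenever exactly one of the three arguments
is taken in `N`. The suffix `₁`, `₂`, `₃` tells which argument lies in `N`. -/
class TriDendModule (k : Type*) (B : Type*) (N : Type*) [Field k] [AddCommGroup B] [Module k B]
    [TriDendriform k B] [AddCommGroup N] [Module k N] where
  lprec : B →ₗ[k] N →ₗ[k] N
  lsucc : B →ₗ[k] N →ₗ[k] N
  ldot : B →ₗ[k] N →ₗ[k] N
  rprec : N →ₗ[k] B →ₗ[k] N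
  rsucc : N →ₗ[k] B →ₗ[k] N
  rdot : N →ₗ[k] B →ₗ[k] N
  prec_prec₁ : ∀ (x : N) (y z : B),
    rprec (rprec x y) z = rprec x (TriDendriform.total k B y z)
  prec_prec₂ : ∀ (x : B) (y : N) (z : B),
    rprec (lprec x y) z = lprec x (rprec y z + rsucc y z + rdot y z)
  prec_prec₃ : ∀ (x y : B) (z : N),
    lprec (TriDendriform.prec (k := k) x y) z = lprec x (lprec y z + lsucc y z + ldot y z)
  succ_prec₁ : ∀ (x : N) (y z : B),
    rprec (rsucc x y) z = rsucc x (TriDendriform.prec (k := k) y z)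
  succ_prec₂ : ∀ (x : B) (y : N) (z : B), rprec (lsucc x y) z = lsucc x (rprec y z)
  succ_prec₃ : ∀ (x y : B) (z : N),
    lprec (TriDendriform.succ (k := k) x y) z = lsucc x (lprec y z)
  succ_succ₁ : ∀ (x : N) (y z : B),
    rsucc (rprec x y + rsucc x y + rdot x y) z = rsucc x (TriDendriform.succ (k := k) y z)
  succ_succ₂ : ∀ (x : B) (y : N) (z : B),
    rsucc (lprec x y + lsucc x y + ldot x y) z = lsucc x (rsucc y z)
  succ_succ₃ : ∀ (x y : B) (z : N),
    lsucc (TriDendriform.total k B x y) z = lsucc x (lsucc y z)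
  succ_dot₁ : ∀ (x : N) (y z : B),
    rsucc x (TriDendriform.dot (k := k) y z) = rdot (rsucc x y) z
  succ_dot₂ : ∀ (x : B) (y : N) (z : B), lsucc x (rdot y z) = rdot (lsucc x y) z
  succ_dot₃ : ∀ (x y : B) (z : N),
    lsucc x (ldot y z) = ldot (TriDendriform.succ (k := k) x y) z
  prec_dot₁ : ∀ (x : N) (y z : B),
    rdot (rprec x y) z = rdot x (TriDendriform.succ (k := k) y z)
  prec_dot₂ : ∀ (x : B) (y : N) (z : B), rdot (lprec x y) z = ldot x (rsucc y z)
  prec_dot₃ : ∀ (x y : B) (z : N),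
    ldot (TriDendriform.prec (k := k) x y) z = ldot x (lsucc y z)
  dot_prec₁ : ∀ (x : N) (y z : B),
    rprec (rdot x y) z = rdot x (TriDendriform.prec (k := k) y z)
  dot_prec₂ : ∀ (x : B) (y : N) (z : B), rprec (ldot x y) z = ldot x (rprec y z)
  dot_prec₃ : ∀ (x y : B) (z : N),
    lprec (TriDendriform.dot (k := k) x y) z = ldot x (lprec y z)
  dot_dot₁ : ∀ (x : N) (y z : B),
    rdot (rdot x y) z = rdot x (TriDendriform.dot (k := k) y z)
  dot_dot₂ : ∀ (x : B) (y : N) (z : B), rdot (ldot x y) z = ldot x (rdot y z)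
  dot_dot₃ : ∀ (x y : B) (z : N),
    ldot (TriDendriform.dot (k := k) x y) z = ldot x (ldot y z)

/-! ### Building blocks of the differentials -/

theorem contractNth_update {R : Type*} (op : R → R → R) {n : ℕ} (j : Fin n) (x : Fin (n + 1) → R)
    (i : Fin (n + 1)) (y : R) :
    Fin.contractNth j.castSucc op (Function.update x i y) =
      Function.update (Fin.contractNth j.castSucc op x) (j.predAbove i)
        (if i = j.castSucc then op y (x j.succ)
          else if i = j.succ then op (x j.castSucc) y else y) := by
  funext m
  obtain ⟨j, hj⟩ := j
  obtain ⟨i, hi⟩ := i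
  obtain ⟨m, hm⟩ := m
  rcases lt_or_ge j i with h | h
  · have : Fin.predAbove ⟨j, hj⟩ ⟨i, hi⟩ = (⟨i - 1, by omega⟩ : Fin n) := by
      rw [Fin.predAbove_of_castSucc_lt _ _ (by simpa [Fin.lt_def] using h)]
      rfl
    rw [this]
    simp only [Fin.contractNth, Function.update_apply, Fin.castSucc_mk, Fin.succ_mk, Fin.mk.injEq]
    grind
  · have : Fin.predAbove ⟨j, hj⟩ ⟨i, hi⟩ = (⟨i, by omega⟩ : Fin n) := by
      rw [Fin.predAbove_of_le_castSucc _ _ (by simpa [Fin.le_def] using h)]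
      rfl
    rw [this]
    simp only [Fin.contractNth, Function.update_apply, Fin.castSucc_mk, Fin.succ_mk, Fin.mk.injEq]
    grind

section Cochains

variable (k : Type*) (R : Type*) (M : Type*) [Field k] [AddCommGroup R] [Module k R]
  [AddCommGroup M] [Module k M]

/-- `n`-linear maps `Rⁿ → M`. -/
abbrev Cochain (n : ℕ) : Type _ := MultilinearMap k (fun _ : Fin n => R) M

variable {k R M}

/-- `(x₀, …, xₙ) ↦ l(x₀, f(x₁, …, xₙ))`, linear in `f`. -/
def leftTerm (l : R →ₗ[k] M →ₗ[k] M) (n : ℕ) : Cochain k R M n →ₗ[k] Cochain k R M (n + 1) where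
  toFun f := LinearMap.uncurryLeft (M := fun _ : Fin (n + 1) => R)
    { toFun := fun x => (l x).compMultilinearMap f
      map_add' := fun x y => by ext; simp
      map_smul' := fun c x => by ext; simp }
  map_add' f g := by ext; simp
  map_smul' c f := by ext; simp

/-- `(x₀, …, xₙ) ↦ r(f(x₀, …, xₙ₋₁), xₙ)`, linear in `f`. -/
def rightTerm (r : M →ₗ[k] R →ₗ[k] M) (n : ℕ) : Cochain k R M n →ₗ[k] Cochain k R M (n + 1) where
  toFun f := MultilinearMap.uncurryRight (M := fun _ : Fin (n + 1) => R) (r.compMultilinearMap f)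
  map_add' f g := by ext; simp
  map_smul' c f := by ext; simp

/-- `(x₀, …, xₙ) ↦ f(x₀, …, op(xⱼ, xⱼ₊₁), …, xₙ)`, linear in `f`. -/
def midTerm (op : R →ₗ[k] R →ₗ[k] R) {n : ℕ} (j : Fin n) :
    Cochain k R M n →ₗ[k] Cochain k R M (n + 1) where
  toFun f :=
    { toFun := fun x => f (Fin.contractNth j.castSucc (fun a b => op a b) x)
      map_update_add' := fun x i a b => by
        rename_i inst
        obtain rfl : inst = instDecidableEqFin (n + 1) := Subsingleton.elim _ _
        simp only [contractNth_update]
        split_ifs <;> simp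
      map_update_smul' := fun x i c a => by
        rename_i inst
        obtain rfl : inst = instDecidableEqFin (n + 1) := Subsingleton.elim _ _
        simp only [contractNth_update]
        split_ifs <;> simp }
  map_add' f g := by ext; simp
  map_smul' c f := by ext; simp

/-- The Hochschild differential of a (not necessarily unital) algebra `R` with product `m` and
coefficients in a bimodule `M` with left and right actions `l`, `r`. Positions are numbered from
`0`, so the summand contracting positions `i` and `i + 1` has sign `(-1) ^ (i + 1)`. -/
def hochD (m : R →ₗ[k] R →ₗ[k] R) (l : R →ₗ[k] M →ₗ[k] M) (r : M →ₗ[k] R →ₗ[k] M) (n : ℕ) :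
    Cochain k R M n →ₗ[k] Cochain k R M (n + 1) :=
  leftTerm l n + ∑ i : Fin n, (-1 : k) ^ ((i : ℕ) + 1) • midTerm m i
    + (-1 : k) ^ (n + 1) • rightTerm r n

end Cochains

/-! ### The tri-dendriform cochain complex -/

/-- Non-empty subsets of the set of `n` input positions. -/
abbrev NESubset (n : ℕ) : Type := {I : Finset (Fin n) // I.Nonempty}

/-- Tri-dendriform `n`-cochains: families `g(I; b₁, …, bₙ)` of `n`-linear maps `Bⁿ → N` indexed by
the non-empty subsets `I` of the set of positions. In degree `0` there is only the zero cochain. -/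
abbrev TriCochain (k B N : Type*) [Field k] [AddCommGroup B] [Module k B] [AddCommGroup N]
    [Module k N] (n : ℕ) : Type _ :=
  NESubset n → Cochain k B N n

/-- The part of `I` in the last `n` positions, renumbered. -/
def tailSet {n : ℕ} (I : Finset (Fin (n + 1))) : Finset (Fin n) :=
  Finset.univ.filter fun j => j.succ ∈ I

/-- The part of `I` in the first `n` positions. -/
def initSet {n : ℕ} (I : Finset (Fin (n + 1))) : Finset (Fin n) :=
  Finset.univ.filter fun j => j.castSucc ∈ I

/-- The image of `I` when positions `i` and `i + 1` are merged into position `i`. -/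
def mergeSet {n : ℕ} (i : Fin n) (I : NESubset (n + 1)) : NESubset n :=
  ⟨I.1.image i.predAbove, I.2.image _⟩

section Tri

variable (k B N : Type*) [Field k] [AddCommGroup B] [Module k B] [TriDendriform k B]
  [AddCommGroup N] [Module k N] [TriDendModule k B N]

open TriDendriform TriDendModule

/-- The operation by which `bᵢ` and `bᵢ₊₁` are multiplied in the component `I` of the differential:
`≺`, `≻`, `·` or the total product, if `I` contains only `i`, only `i + 1`, both or neither. -/
def mergeOp {n : ℕ} (i : Fin n) (I : NESubset (n + 1)) : B →ₗ[k] B →ₗ[k] B :=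
  if i.castSucc ∈ I.1 then (if i.succ ∈ I.1 then dot else prec)
  else (if i.succ ∈ I.1 then succ else total k B)

/-- The first summand of the component `I` of the differential. With `I'` the renumbered part of `I`
in positions other than the first, it is `b₁ · g(I'; b₂, …)` if `I` contains the first position and
another one, `b₁ ≻ g(I'; b₂, …)` if it does not contain the first position, and
`∑ J, b₁ ≺ g(J; b₂, …)` if it consists of the first position alone. -/
def triLeft (n : ℕ) (I : NESubset (n + 1)) : TriCochain k B N n →ₗ[k] Cochain k B N (n + 1) :=
  if h : (tailSet I.1).Nonempty then
    leftTerm (if 0 ∈ I.1 then ldot else lsucc) n ∘ₗ LinearMap.proj ⟨tailSet I.1, h⟩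
  else leftTerm lprec n ∘ₗ ∑ J : NESubset n, LinearMap.proj J

/-- The last summand of the component `I` of the differential. With `I'` the part of `I` in
positions other than the last, it is `g(I'; …, bₙ) · bₙ₊₁` if `I` contains the last position and
another one, `g(I'; …, bₙ) ≺ bₙ₊₁` if it does not contain the last position, and
`∑ J, g(J; …, bₙ) ≻ bₙ₊₁` if it consists of the last position alone. -/
def triRight (n : ℕ) (I : NESubset (n + 1)) : TriCochain k B N n →ₗ[k] Cochain k B N (n + 1) :=
  if h : (initSet I.1).Nonempty then
    rightTerm (if Fin.last n ∈ I.1 then rdot else rprec) n ∘ₗ LinearMap.proj ⟨initSet I.1, h⟩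
  else rightTerm rsucc n ∘ₗ ∑ J : NESubset n, LinearMap.proj J

/-- The tri-dendriform differential. -/
def triD (n : ℕ) : TriCochain k B N n →ₗ[k] TriCochain k B N (n + 1) :=
  LinearMap.pi fun I =>
    triLeft k B N n I
      + ∑ i : Fin n, (-1 : k) ^ ((i : ℕ) + 1) •
          (midTerm (mergeOp k B i I) i ∘ₗ LinearMap.proj (mergeSet i I))
      + (-1 : k) ^ (n + 1) • triRight k B N n I

end Tri

/-! ### The associative algebra `A ⊗ B` and its bimodule `A ⊗ N` -/

section Tensor

variable (k A B N : Type*) [Field k] [AddCommGroup A] [Module k A] [CommTriAlgebra k A]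
  [AddCommGroup B] [Module k B] [TriDendriform k B]
  [AddCommGroup N] [Module k N] [TriDendModule k B N]

open CommTriAlgebra TriDendriform TriDendModule

/-- The product of `A ⊗ B`:
`(a₁ ⊗ b₁)(a₂ ⊗ b₂) = (a₁ ∗ a₂) ⊗ (b₁ ≺ b₂) + (a₂ ∗ a₁) ⊗ (b₁ ≻ b₂) + (a₁ • a₂) ⊗ (b₁ · b₂)`. -/
def tensorMul : A ⊗[k] B →ₗ[k] A ⊗[k] B →ₗ[k] A ⊗[k] B :=
  TensorProduct.map₂ ast prec + TensorProduct.map₂ ast.flip succ + TensorProduct.map₂ bul dot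

/-- The left action of `A ⊗ B` on `A ⊗ N`, by the same formula with the second tensor in `A ⊗ N`. -/
def tensorLeft : A ⊗[k] B →ₗ[k] A ⊗[k] N →ₗ[k] A ⊗[k] N :=
  TensorProduct.map₂ ast lprec + TensorProduct.map₂ ast.flip lsucc + TensorProduct.map₂ bul ldot

/-- The right action of `A ⊗ B` on `A ⊗ N`, by the same formula with the first tensor in `A ⊗ N`. -/
def tensorRight : A ⊗[k] N →ₗ[k] A ⊗[k] B →ₗ[k] A ⊗[k] N :=
  TensorProduct.map₂ ast rprec + TensorProduct.map₂ ast.flip rsucc + TensorProduct.map₂ bul rdot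

/-- The Hochschild differential on `C*(A ⊗ B, A ⊗ N)`. -/
abbrev tensorHochD (n : ℕ) :
    Cochain k (A ⊗[k] B) (A ⊗[k] N) n →ₗ[k] Cochain k (A ⊗[k] B) (A ⊗[k] N) (n + 1) :=
  hochD (tensorMul k A B) (tensorLeft k A B N) (tensorRight k A B N) n

variable {A}

/-- `P(a₁, …, aₙ; I) = (a_{i₁} • ⋯ • a_{iₖ}) ∗ (a_{j₁} ∗ ⋯ ∗ a_{jₙ₋ₖ})`, where `i₁ < ⋯ < iₖ` are the
elements of `I` and `j₁ < ⋯ < jₙ₋ₖ` the remaining positions; the second factor is omitted if there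
are none. (Only used for non-empty `I`; the value `0` for empty `I` is a dummy.) -/
def monomialP {n : ℕ} (a : Fin n → A) (I : Finset (Fin n)) : A :=
  match ((List.finRange n).filter (· ∈ I)).map a, ((List.finRange n).filter (· ∉ I)).map a with
  | [], _ => 0
  | x :: xs, [] => xs.foldl (fun u v => bul (k := k) u v) x
  | x :: xs, y :: ys =>
      ast (k := k) (xs.foldl (fun u v => bul (k := k) u v) x) (ys.foldl (fun u v => ast (k := k) u v) y)

end Tensor

/-! ### Embedding a commutative tri-algebra into a commutative ring -/

/-! The proof rests on making commutative tri-algebras into ordinary commutative algebra. Any such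
`A` embeds by a linear map `u` into a commutative ring `T` that carries a second linear map `v`,
with u(x • y) = u(x)u(y), u(x ∗ y) = u(x)v(y) and v multiplicative for both products
(`exists_embedding`). Then u(P(a; I)) is the product over all positions j of u(a_j) for j ∈ I and
v(a_j) for j ∉ I (`map_monomialP`). This makes P multilinear and turns every identity between
monomials into a comparison of factors in `T`.

The cochain map property is a matching of summands. For the outer terms, a non-empty set of
positions is {p}, or a non-empty set J of the other positions, or J ∪ {p}; these give a_p ∗ P(J),
P(J) ∗ a_p and a_p • P(J). The first does not depend on J, because v does not distinguish the two
products; hence the sums over J in δ_tri. For an inner term, the three summands of the product at i,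
i + 1 correspond to the sets I with i + 1 ∉ I, with i ∉ I, and with both or neither in I. Sets
containing neither occur three times, which produces the total product ∘.

Injectivity needs one tuple a whose monomials P(a; I) are linearly independent. It is found by
mapping the free algebra to k[s, t] with x ∗ y = x·f(y), where f sends s and t to t, and separating
the sets I by binary expansions.

Finally δ_HH² = 0 is the usual cosimplicial argument, and δ_tri² = 0 is not computed at all: it is
pulled back along the injective cochain map. -/

open scoped IsMulCommutative in
theorem Algebra.exists_commRing_of_commuting.{u, w} {k : Type u} {E : Type w} [CommRing k] [Ring E]
    [Algebra k E] (s : Set E) (hs : ∀ a ∈ s, ∀ b ∈ s, a * b = b * a) :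
    ∃ (T : Type w) (_ : CommRing T) (_ : Algebra k T) (i : T →ₐ[k] E), Function.Injective i ∧
      ∀ x ∈ s, ∃ t, i t = x :=
  have := Algebra.isMulCommutative_adjoin k hs
  ⟨Algebra.adjoin k s, inferInstance, inferInstance, (Algebra.adjoin k s).val,
    Subtype.val_injective, fun x hx => ⟨⟨x, Algebra.subset_adjoin hx⟩, rfl⟩⟩

namespace CommTriAlgebra

variable (k : Type*) {A : Type*} [Field k] [AddCommGroup A] [Module k A] [CommTriAlgebra k A]

theorem ast_ast_right_comm (x y z : A) :
    ast (k := k) (ast (k := k) x y) z = ast (k := k) (ast (k := k) x z) y := by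
  rw [ast_assoc, ast_perm, ast_assoc]

variable (A) in
/-- The endomorphisms that commute with all multiplications `x • -` and `- ∗ y`. -/
def multipliers : Submodule k (Module.End k A) where
  carrier := {s | ∀ x y : A, s (bul (k := k) x y) = bul (k := k) x (s y) ∧
    s (ast (k := k) x y) = ast (k := k) (s x) y}
  add_mem' {s t} hs ht x y := by simp [hs x y, ht x y]
  zero_mem' x y := by simp
  smul_mem' c s hs x y := by simp [hs x y]

/-- The action of `A` on `multipliers k A × A` in which `x` multiplies as an element of `A`. -/
def bulAction : A →ₗ[k] Module.End k (multipliers k A × A) :=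
  LinearMap.mk₂ k (fun x m => (0, m.1.1 x + bul (k := k) x m.2))
    (fun x y m => by ext <;> simp; abel) (fun c x m => by ext <;> simp)
    (fun x m n => by ext <;> simp; abel) (fun c x m => by ext <;> simp)

/-- The action of `A` on `multipliers k A × A` in which `y` acts through `- ∗ y`. -/
def astAction : A →ₗ[k] Module.End k (multipliers k A × A) :=
  LinearMap.mk₂ k (fun y m => (⟨(ast (k := k)).flip y ∘ₗ m.1.1, fun x z => by
      obtain ⟨s, hs⟩ := m.1
      simp [(hs x z).1, (hs x z).2, bul_ast, ast_ast_right_comm k _ z y]⟩,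
      ast (k := k) m.2 y))
    (fun x y m => by ext <;> simp) (fun c x m => by ext <;> simp)
    (fun x m n => by ext <;> simp) (fun c x m => by ext <;> simp)

theorem bulAction_apply (x : A) (m : multipliers k A × A) :
    bulAction k x m = (0, m.1.1 x + bul (k := k) x m.2) := rfl

theorem astAction_apply_fst (y x : A) (m : multipliers k A × A) :
    (astAction k y m).1.1 x = ast (k := k) (m.1.1 x) y := rfl

theorem astAction_apply_snd (y : A) (m : multipliers k A × A) :
    (astAction k y m).2 = ast (k := k) m.2 y := rfl

/-- The identity is a multiplier, and x sends (id, 0) to (0, x). The factor `multipliers k A` thus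
plays the role of an adjoined unit, making the action faithful. -/
theorem bulAction_injective : Function.Injective (bulAction k (A := A)) := by
  intro x y h
  have := congrArg (fun e => (e (⟨LinearMap.id, fun x y => by simp⟩, 0)).2) h
  simpa [bulAction_apply] using this

theorem bulAction_bul (x y : A) :
    bulAction k (bul (k := k) x y) = bulAction k x * bulAction k y := by
  refine LinearMap.ext fun m => Prod.ext (Subtype.ext (LinearMap.ext fun z => ?_)) ?_
  · simp [bulAction_apply]
  -- The first multiplier condition s(x • y) = x • s(y) is needed exactly here.
  · simp [bulAction_apply, (m.1.2 x y).1, bul_assoc]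

theorem bulAction_ast (x y : A) :
    bulAction k (ast (k := k) x y) = bulAction k x * astAction k y := by
  refine LinearMap.ext fun m => Prod.ext (Subtype.ext (LinearMap.ext fun z => ?_)) ?_
  · simp [bulAction_apply]
  · simp only [bulAction_apply, Module.End.mul_apply, astAction_apply_fst, astAction_apply_snd,
      (m.1.2 x y).2]
    rw [bul_comm, ← bul_ast, bul_comm, bul_ast]

theorem commute_bulAction_astAction (x y : A) :
    astAction k y * bulAction k x = bulAction k x * astAction k y := by
  refine LinearMap.ext fun m => Prod.ext (Subtype.ext (LinearMap.ext fun z => ?_)) ?_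
  · simp [bulAction_apply, astAction_apply_fst]
  · simp [bulAction_apply, astAction_apply_fst, astAction_apply_snd, bul_ast]

theorem astAction_ast (x y : A) :
    astAction k (ast (k := k) x y) = astAction k x * astAction k y := by
  refine LinearMap.ext fun m => Prod.ext (Subtype.ext (LinearMap.ext fun z => ?_)) ?_
  · simp only [astAction_apply_fst, Module.End.mul_apply]
    -- Composition of operators reverses the order of the factors; the Perm identity restores it.
    rw [ast_assoc, ast_perm]
  · simp only [astAction_apply_snd, Module.End.mul_apply]
    rw [ast_assoc, ast_perm]

theorem astAction_bul (x y : A) :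
    astAction k (bul (k := k) x y) = astAction k x * astAction k y := by
  rw [← astAction_ast]
  refine LinearMap.ext fun m => Prod.ext (Subtype.ext (LinearMap.ext fun z => ?_)) ?_
  · simp only [astAction_apply_fst, ast_bul]
  · simp only [astAction_apply_snd, ast_bul]

/-- Every commutative tri-algebra embeds (by `u`) into a commutative ring with a second linear map
`v` such that `u (x • y) = u x * u y` and `u (x ∗ y) = u x * v y`. -/
theorem exists_embedding.{u, w} (k : Type u) (A : Type w) [Field k] [AddCommGroup A] [Module k A]
    [CommTriAlgebra k A] : ∃ (T : Type w) (_ : CommRing T) (_ : Algebra k T) (u v : A →ₗ[k] T),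
    Function.Injective u ∧ (∀ x y, u (bul (k := k) x y) = u x * u y) ∧
    (∀ x y, u (ast (k := k) x y) = u x * v y) ∧ (∀ x y, v (bul (k := k) x y) = v x * v y) ∧
    (∀ x y, v (ast (k := k) x y) = v x * v y) := by
  let s : Set (Module.End k (multipliers k A × A)) :=
    Set.range (bulAction k (A := A)) ∪ Set.range (astAction k (A := A))
  have hs : ∀ a ∈ s, ∀ b ∈ s, a * b = b * a := by
    rintro _ (⟨x, rfl⟩ | ⟨x, rfl⟩) _ (⟨y, rfl⟩ | ⟨y, rfl⟩)
    · rw [← bulAction_bul, bul_comm, bulAction_bul]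
    · rw [commute_bulAction_astAction]
    · rw [commute_bulAction_astAction]
    · rw [← astAction_bul, bul_comm, astAction_bul]
  -- `T` is the subalgebra generated by all these commuting operators; identities for `u` and `v`
  -- are checked on operators through the injection `i`.
  obtain ⟨T, _, _, i, hi, hsT⟩ := Algebra.exists_commRing_of_commuting (k := k) s hs
  choose u hu using fun x : A => hsT _ (Or.inl ⟨x, rfl⟩)
  choose v hv using fun x : A => hsT _ (Or.inr ⟨x, rfl⟩)
  refine ⟨T, inferInstance, inferInstance,
    { toFun := u
      map_add' := fun x y => hi (by simp [hu])
      map_smul' := fun c x => hi (by simp [hu]) },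
    { toFun := v
      map_add' := fun x y => hi (by simp [hv])
      map_smul' := fun c x => hi (by simp [hv]) }, ?_, ?_, ?_, ?_, ?_⟩
  · intro x y h
    refine bulAction_injective k ?_
    rw [← hu, ← hu]
    exact congrArg i h
  · exact fun x y => hi (by simp [hu, bulAction_bul])
  · exact fun x y => hi (by simp [hu, hv, bulAction_ast])
  · exact fun x y => hi (by simp [hv, astAction_bul])
  · exact fun x y => hi (by simp [hv, astAction_ast])

end CommTriAlgebra

/-! ### The monomials `P(a₁, …, aₙ; I)` -/

theorem List.prod_map_ite_eq_filter_mul_filter {T ι : Type*} [CommMonoid T] (l : List ι)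
    (p : ι → Prop) [DecidablePred p] (f g : ι → T) :
    (l.map fun j => if p j then f j else g j).prod =
      ((l.filter (p ·)).map f).prod * ((l.filter (¬ p ·)).map g).prod := by
  induction l with
  | nil => simp
  | cons j l ih =>
    by_cases h : p j
    · simp_all [mul_assoc]
    · simp_all [mul_left_comm]

theorem List.map_foldl_eq_mul_prod {T A : Type*} [Monoid T] (w : A → T) (w' : A → T)
    (op : A → A → A) (hw : ∀ x y, w (op x y) = w x * w' y) (l : List A) (x : A) :
    w (l.foldl op x) = w x * (l.map w').prod := by
  induction l generalizing x with
  | nil => simp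
  | cons y l ih => simp [ih, hw, mul_assoc]

namespace CommTriAlgebra

variable {k : Type*} {A : Type*} [Field k] [AddCommGroup A] [Module k A] [CommTriAlgebra k A]

section Embedded

variable {T : Type*} [CommRing T] [Algebra k T] {u v : A →ₗ[k] T}

/-- A map that turns `•` into products and `∗` into twisted products sends `P(a; I)` to a product
over all positions. -/
theorem map_monomialP (hb : ∀ x y, u (bul (k := k) x y) = u x * u y)
    (ha : ∀ x y, u (ast (k := k) x y) = u x * v y)
    (hv : ∀ x y, v (ast (k := k) x y) = v x * v y) {n : ℕ} (a : Fin n → A) {I : Finset (Fin n)}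
    (hI : I.Nonempty) :
    u (monomialP k a I) = ∏ j, (if j ∈ I then u else v) (a j) := by
  have h0 : ∀ j, (if j ∈ I then u else v) (a j) = if j ∈ I then u (a j) else v (a j) :=
    fun j => by split_ifs <;> rfl
  simp only [h0]
  rw [Fin.prod_univ_def, List.prod_map_ite_eq_filter_mul_filter]
  have h1 : ∀ w : A → T, ∀ l : List (Fin n),
      (l.map fun j => w (a j)).prod = ((l.map a).map w).prod := by simp [Function.comp_def]
  rw [h1 u, h1 v, monomialP]
  -- Non-emptiness of I rules out the dummy branch of `monomialP`.
  have hne : ((List.finRange n).filter (· ∈ I)).map a ≠ [] := by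
    obtain ⟨i, hi⟩ := hI
    intro h
    have : i ∈ (List.finRange n).filter (· ∈ I) := by simpa using hi
    simp_all
  generalize ((List.finRange n).filter (· ∈ I)).map a = l at hne
  generalize ((List.finRange n).filter (¬ · ∈ I)).map a = l'
  match l, l' with
  | x :: xs, [] => simp [List.map_foldl_eq_mul_prod u u _ hb]
  | x :: xs, y :: ys =>
    simp [List.map_foldl_eq_mul_prod u u _ hb, List.map_foldl_eq_mul_prod v v _ hv, ha]

end Embedded

/-- `P(a₁, …, aₙ; I)` as a multilinear map in `a₁, …, aₙ`. -/
def monomialMap {n : ℕ} (I : NESubset n) : MultilinearMap k (fun _ : Fin n => A) A where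
  toFun a := monomialP k a I.1
  map_update_add' a i x y := by
    rename_i inst
    obtain rfl : inst = instDecidableEqFin n := Subsingleton.elim _ _
    obtain ⟨T, _, _, u, v, hu, hb, ha, -, hv⟩ := exists_embedding k A
    -- After `u`, the monomial is a product of linear forms in the separate a_j, which is visibly
    -- multilinear.
    apply hu
    simp only [map_add, map_monomialP hb ha hv _ I.2]
    have := (MultilinearMap.mkPiAlgebra k (Fin n) T).compLinearMap
      (fun j => if j ∈ I.1 then u else v) |>.map_update_add a i x y
    simpa only [MultilinearMap.compLinearMap_apply, MultilinearMap.mkPiAlgebra_apply] using this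
  map_update_smul' a i c x := by
    rename_i inst
    obtain rfl : inst = instDecidableEqFin n := Subsingleton.elim _ _
    obtain ⟨T, _, _, u, v, hu, hb, ha, -, hv⟩ := exists_embedding k A
    apply hu
    simp only [map_smul, map_monomialP hb ha hv _ I.2]
    have := (MultilinearMap.mkPiAlgebra k (Fin n) T).compLinearMap
      (fun j => if j ∈ I.1 then u else v) |>.map_update_smul a i c x
    simpa only [MultilinearMap.compLinearMap_apply, MultilinearMap.mkPiAlgebra_apply] using this

end CommTriAlgebra

/-! ### Multilinear maps on tensor products -/

section TensorMultilinear

variable {k A B M N : Type*} [Field k] [AddCommGroup A] [Module k A] [AddCommGroup B] [Module k B]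
  [AddCommGroup M] [Module k M] [AddCommGroup N] [Module k N]

/-- A multilinear map on a tensor product is determined by its values on elementary tensors. -/
theorem MultilinearMap.ext_tmul {n : ℕ} {f g : MultilinearMap k (fun _ : Fin n => A ⊗[k] B) M}
    (h : ∀ (a : Fin n → A) (b : Fin n → B),
      f (fun i => a i ⊗ₜ[k] b i) = g (fun i => a i ⊗ₜ[k] b i)) : f = g := by
  induction n with
  | zero => ext x; rw [Subsingleton.elim x fun i => (0 : Fin 0 → A) i ⊗ₜ[k] (0 : Fin 0 → B) i, h]
  | succ n ih =>
    suffices h' : f.curryLeft = g.curryLeft by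
      rw [← MultilinearMap.uncurry_curryLeft f, h', MultilinearMap.uncurry_curryLeft]
    refine TensorProduct.ext' fun a b => ih fun a' b' => ?_
    have e : (Fin.cons (a ⊗ₜ[k] b) fun i => a' i ⊗ₜ[k] b' i : Fin (n + 1) → A ⊗[k] B) =
        fun i => (Fin.cons a a' : Fin (n + 1) → A) i ⊗ₜ[k] (Fin.cons b b' : Fin (n + 1) → B) i := by
      funext i
      refine Fin.cases ?_ (fun i => ?_) i <;> simp
    simp only [MultilinearMap.curryLeft_apply, e, h]

variable (k A B M N) in
/-- The tensor product of multilinear maps `Aⁿ → M` and `Bⁿ → N` as a multilinear map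
`(A ⊗ B)ⁿ → M ⊗ N`. -/
noncomputable def tensorMultilinear : (n : ℕ) →
    MultilinearMap k (fun _ : Fin n => A) M →ₗ[k] MultilinearMap k (fun _ : Fin n => B) N →ₗ[k]
      MultilinearMap k (fun _ : Fin n => A ⊗[k] B) (M ⊗[k] N)
  | 0 => LinearMap.mk₂ k
      (fun f g => MultilinearMap.constOfIsEmpty k _ (f 0 ⊗ₜ[k] g 0))
      (fun f f' g => by ext; simp [TensorProduct.add_tmul])
      (fun c f g => by ext; simp [TensorProduct.smul_tmul'])
      (fun f g g' => by ext; simp [TensorProduct.tmul_add])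
      (fun c f g => by ext; simp)
  | n + 1 => LinearMap.mk₂ k
      (fun f g => LinearMap.uncurryLeft (M := fun _ : Fin (n + 1) => A ⊗[k] B)
        (TensorProduct.lift ((tensorMultilinear n).compl₁₂ f.curryLeft g.curryLeft)))
      (fun f f' g => MultilinearMap.ext_tmul fun a b => by
        simp [show (f + f').curryLeft = f.curryLeft + f'.curryLeft from rfl])
      (fun c f g => MultilinearMap.ext_tmul fun a b => by
        simp [show (c • f).curryLeft = c • f.curryLeft from rfl])
      (fun f g g' => MultilinearMap.ext_tmul fun a b => by
        simp [show (g + g').curryLeft = g.curryLeft + g'.curryLeft from rfl])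
      (fun c f g => MultilinearMap.ext_tmul fun a b => by
        simp [show (c • g).curryLeft = c • g.curryLeft from rfl])

theorem tensorMultilinear_tmul {n : ℕ} (f : MultilinearMap k (fun _ : Fin n => A) M)
    (g : MultilinearMap k (fun _ : Fin n => B) N) (a : Fin n → A) (b : Fin n → B) :
    tensorMultilinear k A B M N n f g (fun i => a i ⊗ₜ[k] b i) = f a ⊗ₜ[k] g b := by
  induction n with
  | zero => simp [tensorMultilinear, Subsingleton.elim a 0, Subsingleton.elim b 0]
  | succ n ih =>
    simp only [tensorMultilinear, LinearMap.mk₂_apply, LinearMap.uncurryLeft_apply,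
      TensorProduct.lift.tmul, LinearMap.compl₁₂_apply]
    refine (ih _ _ (Fin.tail a) (Fin.tail b)).trans ?_
    simp [MultilinearMap.curryLeft_apply, Fin.cons_self_tail]

end TensorMultilinear

/-! ### The comparison map -/

section Comparison

variable (k A B N : Type*) [Field k] [AddCommGroup A] [Module k A] [CommTriAlgebra k A]
  [AddCommGroup B] [Module k B] [AddCommGroup N] [Module k N]

/-- The map from tri-dendriform cochains to Hochschild cochains. -/
noncomputable def comparison (n : ℕ) :
    TriCochain k B N n →ₗ[k] Cochain k (A ⊗[k] B) (A ⊗[k] N) n :=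
  ∑ I : NESubset n, tensorMultilinear k A B A N n (CommTriAlgebra.monomialMap I) ∘ₗ
    LinearMap.proj I

variable {k A B N} in
theorem comparison_tmul {n : ℕ} (g : TriCochain k B N n) (a : Fin n → A) (b : Fin n → B) :
    comparison k A B N n g (fun i => a i ⊗ₜ[k] b i) =
      ∑ I : NESubset n, monomialP k a I.1 ⊗ₜ[k] g I b := by
  simp only [comparison, LinearMap.sum_apply, _root_.sum_apply, LinearMap.comp_apply,
    LinearMap.proj_apply, tensorMultilinear_tmul]
  rfl

end Comparison

/-! ### `A ⊗ B` is an associative algebra and `A ⊗ N` a bimodule -/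

section Bimodule

variable {k A B N : Type*} [Field k] [AddCommGroup A] [Module k A] [CommTriAlgebra k A]
  [AddCommGroup B] [Module k B] [TriDendriform k B]
  [AddCommGroup N] [Module k N] [TriDendModule k B N]

open CommTriAlgebra TriDendriform TriDendModule

/-- Both sides equal (x • z) ∗ y: a right ∗-factor may move freely across •. -/
theorem CommTriAlgebra.bul_ast_left (x y z : A) :
    bul (k := k) (ast (k := k) x y) z = bul (k := k) x (ast (k := k) z y) := by
  rw [bul_comm, ← bul_ast, bul_comm z, bul_ast]

theorem TriDendriform.total_apply (x y : B) :
    total k B x y = prec (k := k) x y + succ (k := k) x y + dot (k := k) x y := rfl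

/-- Two bracketings of a triple product in `A ⊗ -` agree once the nine products in the second
factor are matched by the seven tri-dendriform identities. -/
theorem sum_bracketings_eq (N : Type*) [AddCommGroup N] [Module k N] (x y z : A)
    {pp sp dp ps ss ds pd sd dd p_p p_s p_d s_p s_s s_d d_p d_s d_d : N}
    (h1 : pp = p_p + p_s + p_d) (h2 : sp = s_p) (h3 : ps + ss + ds = s_s) (h4 : s_d = sd)
    (h5 : pd = d_s) (h6 : dp = d_p) (h7 : dd = d_d) :
    (ast (k := k) (ast (k := k) x y) z ⊗ₜ[k] pp + ast (k := k) (ast (k := k) y x) z ⊗ₜ[k] sp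
        + ast (k := k) (bul (k := k) x y) z ⊗ₜ[k] dp)
      + (ast (k := k) z (ast (k := k) x y) ⊗ₜ[k] ps + ast (k := k) z (ast (k := k) y x) ⊗ₜ[k] ss
        + ast (k := k) z (bul (k := k) x y) ⊗ₜ[k] ds)
      + (bul (k := k) (ast (k := k) x y) z ⊗ₜ[k] pd + bul (k := k) (ast (k := k) y x) z ⊗ₜ[k] sd
        + bul (k := k) (bul (k := k) x y) z ⊗ₜ[k] dd)
    = (ast (k := k) x (ast (k := k) y z) ⊗ₜ[k] p_p + ast (k := k) x (ast (k := k) z y) ⊗ₜ[k] p_s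
        + ast (k := k) x (bul (k := k) y z) ⊗ₜ[k] p_d)
      + (ast (k := k) (ast (k := k) y z) x ⊗ₜ[k] s_p + ast (k := k) (ast (k := k) z y) x ⊗ₜ[k] s_s
        + ast (k := k) (bul (k := k) y z) x ⊗ₜ[k] s_d)
      + (bul (k := k) x (ast (k := k) y z) ⊗ₜ[k] d_p + bul (k := k) x (ast (k := k) z y) ⊗ₜ[k] d_s
        + bul (k := k) x (bul (k := k) y z) ⊗ₜ[k] d_d) := by
  -- The left tensor factors are the seven monomials P(x, y, z; I); the hypotheses, one for each
  -- non-empty I ⊆ {1, 2, 3}, say that their coefficients on the two sides agree.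
  subst h1 h2 h3 h4 h5 h6 h7
  rw [bul_ast_left y, bul_comm y (ast z x), bul_ast_left z]
  simp only [ast_assoc, ast_bul, bul_ast, bul_assoc, bul_ast_left, ast_perm x z y, ast_perm z y x,
    ast_perm y z x, TensorProduct.tmul_add, bul_comm y]
  abel

theorem tensorMul_assoc (x y z : A ⊗[k] B) :
    tensorMul k A B (tensorMul k A B x y) z = tensorMul k A B x (tensorMul k A B y z) := by
  induction x with
  | zero => simp
  | add _ _ h h' => simp [h, h']
  | tmul a x =>
  induction y with
  | zero => simp
  | add _ _ h h' => simp [h, h']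
  | tmul b y =>
  induction z with
  | zero => simp
  | add _ _ h h' => simp [h, h']
  | tmul c z =>
  simp only [tensorMul, LinearMap.add_apply, TensorProduct.map₂_apply_tmul, map_add,
    TensorProduct.map_tmul, LinearMap.flip_apply]
  have := sum_bracketings_eq (k := k) B a b c ((prec_prec (k := k) x y z).trans (by simp only [map_add]; rfl))
    (succ_prec (k := k) x y z) (.trans (by simp only [map_add, LinearMap.add_apply]; rfl) (succ_succ (k := k) x y z))
    (succ_dot (k := k) x y z) (prec_dot (k := k) x y z) (dot_prec (k := k) x y z) (dot_dot (k := k) x y z)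
  -- Goal and `this` differ only in the grouping and order of summands, so their differences are
  -- compared.
  rw [← sub_eq_zero] at this ⊢
  rw [← this]
  abel

theorem tensorLeft_tensorMul (x y : A ⊗[k] B) (z : A ⊗[k] N) :
    tensorLeft k A B N (tensorMul k A B x y) z = tensorLeft k A B N x (tensorLeft k A B N y z) := by
  induction x with
  | zero => simp
  | add _ _ h h' => simp [h, h']
  | tmul a x =>
  induction y with
  | zero => simp
  | add _ _ h h' => simp [h, h']
  | tmul b y =>
  induction z with
  | zero => simp
  | add _ _ h h' => simp [h, h']
  | tmul c z =>
  simp only [tensorMul, tensorLeft, LinearMap.add_apply, TensorProduct.map₂_apply_tmul, map_add,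
    TensorProduct.map_tmul, LinearMap.flip_apply]
  have := sum_bracketings_eq (k := k) N a b c ((prec_prec₃ (k := k) x y z).trans (by simp only [map_add]; rfl))
    (succ_prec₃ (k := k) x y z)
    (.trans (by simp only [total_apply, map_add, LinearMap.add_apply]; rfl) (succ_succ₃ (k := k) x y z))
    (succ_dot₃ (k := k) x y z) (prec_dot₃ (k := k) x y z) (dot_prec₃ (k := k) x y z) (dot_dot₃ (k := k) x y z)
  rw [← sub_eq_zero] at this ⊢
  rw [← this]
  abel

theorem tensorRight_tensorLeft (x z : A ⊗[k] B) (y : A ⊗[k] N) :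
    tensorRight k A B N (tensorLeft k A B N x y) z
      = tensorLeft k A B N x (tensorRight k A B N y z) := by
  induction x with
  | zero => simp
  | add _ _ h h' => simp [h, h']
  | tmul a x =>
  induction y with
  | zero => simp
  | add _ _ h h' => simp [h, h']
  | tmul b y =>
  induction z with
  | zero => simp
  | add _ _ h h' => simp [h, h']
  | tmul c z =>
  simp only [tensorRight, tensorLeft, LinearMap.add_apply, TensorProduct.map₂_apply_tmul, map_add,
    TensorProduct.map_tmul, LinearMap.flip_apply]
  have := sum_bracketings_eq (k := k) N a b c ((prec_prec₂ (k := k) x y z).trans (by simp only [map_add]; rfl))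
    (succ_prec₂ (k := k) x y z) (.trans (by simp only [map_add, LinearMap.add_apply]; rfl) (succ_succ₂ (k := k) x y z))
    (succ_dot₂ (k := k) x y z) (prec_dot₂ (k := k) x y z) (dot_prec₂ (k := k) x y z) (dot_dot₂ (k := k) x y z)
  rw [← sub_eq_zero] at this ⊢
  rw [← this]
  abel

theorem tensorRight_tensorMul (y z : A ⊗[k] B) (x : A ⊗[k] N) :
    tensorRight k A B N (tensorRight k A B N x y) z
      = tensorRight k A B N x (tensorMul k A B y z) := by
  induction x with
  | zero => simp
  | add _ _ h h' => simp [h, h']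
  | tmul a x =>
  induction y with
  | zero => simp
  | add _ _ h h' => simp [h, h']
  | tmul b y =>
  induction z with
  | zero => simp
  | add _ _ h h' => simp [h, h']
  | tmul c z =>
  simp only [tensorRight, tensorMul, LinearMap.add_apply, TensorProduct.map₂_apply_tmul, map_add,
    TensorProduct.map_tmul, LinearMap.flip_apply]
  have := sum_bracketings_eq (k := k) N a b c
    ((prec_prec₁ (k := k) x y z).trans (by simp only [total_apply, map_add]; rfl))
    (succ_prec₁ (k := k) x y z) (.trans (by simp only [map_add, LinearMap.add_apply]; rfl) (succ_succ₁ (k := k) x y z))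
    (succ_dot₁ (k := k) x y z) (prec_dot₁ (k := k) x y z) (dot_prec₁ (k := k) x y z) (dot_dot₁ (k := k) x y z)
  rw [← sub_eq_zero] at this ⊢
  rw [← this]
  abel

end Bimodule

/-! ### The Hochschild differential squares to zero -/

section Hochschild

variable {k R M : Type*} [Field k] [AddCommGroup R] [Module k R] [AddCommGroup M] [Module k M]

theorem leftTerm_apply (l : R →ₗ[k] M →ₗ[k] M) {n : ℕ} (f : Cochain k R M n) (x : Fin (n + 1) → R) :
    leftTerm l n f x = l (x 0) (f (Fin.tail x)) := rfl

theorem rightTerm_apply (r : M →ₗ[k] R →ₗ[k] M) {n : ℕ} (f : Cochain k R M n)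
    (x : Fin (n + 1) → R) : rightTerm r n f x = r (f (Fin.init x)) (x (Fin.last n)) := rfl

theorem midTerm_apply (op : R →ₗ[k] R →ₗ[k] R) {n : ℕ} (j : Fin n) (f : Cochain k R M n)
    (x : Fin (n + 1) → R) :
    midTerm op j f x = f (Fin.contractNth j.castSucc (fun a b => op a b) x) := rfl

/-- The alternating sum of coface maps squares to zero. -/
theorem alternating_coface_comp_eq_zero {C : ℕ → Type*} [∀ n, AddCommGroup (C n)]
    [∀ n, Module k (C n)] {n : ℕ} (d : Fin (n + 2) → C n →ₗ[k] C (n + 1))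
    (d' : Fin (n + 3) → C (n + 1) →ₗ[k] C (n + 2))
    (h : ∀ i j : Fin (n + 2), i ≤ j → d' j.succ ∘ₗ d i = d' i.castSucc ∘ₗ d j) :
    (∑ j : Fin (n + 3), (-1 : k) ^ (j : ℕ) • d' j) ∘ₗ (∑ i : Fin (n + 2), (-1 : k) ^ (i : ℕ) • d i) = 0 := by
  have e : (∑ j : Fin (n + 3), (-1 : k) ^ (j : ℕ) • d' j) ∘ₗ (∑ i : Fin (n + 2), (-1 : k) ^ (i : ℕ) • d i) =
      ∑ p : Fin (n + 3) × Fin (n + 2), (-1 : k) ^ ((p.1 : ℕ) + p.2) • (d' p.1 ∘ₗ d p.2) := by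
    ext x
    simp [Fintype.sum_prod_type, LinearMap.sum_apply, Finset.smul_sum, pow_add, smul_smul]
  -- Pairs (j, i) with i < j are matched with the remaining ones by (j, i) ↦ (i, j − 1); the coface
  -- relation makes the two composites equal, and the signs are opposite.
  rw [e, ← Finset.sum_filter_add_sum_filter_not _ (fun p => p.2.castSucc < p.1),
    add_eq_zero_iff_eq_neg, ← Finset.sum_neg_distrib]
  refine Finset.sum_bij' (fun p hp => (p.2.castSucc, p.1.pred (by
      simp only [Finset.mem_filter] at hp
      exact Fin.ne_zero_of_lt hp.2)))
    (fun p hp => (p.2.succ, p.1.castPred (by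
      simp only [Finset.mem_filter] at hp
      exact Fin.ne_last_of_lt (lt_of_le_of_lt (not_lt.1 hp.2) (Fin.castSucc_lt_last _)))))
    ?_ ?_ ?_ ?_ ?_
  · rintro ⟨j, i⟩ hp
    simp only [Finset.mem_filter, Finset.mem_univ, true_and, Fin.lt_def, Fin.val_castSucc,
      Fin.val_pred] at hp ⊢
    omega
  · rintro ⟨j, i⟩ hp
    simp only [Finset.mem_filter, Finset.mem_univ, true_and, Fin.lt_def, Fin.val_castSucc,
      Fin.val_succ, Fin.coe_castPred] at hp ⊢
    omega
  · rintro ⟨j, i⟩ hp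
    simp
  · rintro ⟨j, i⟩ hp
    simp
  · rintro ⟨j, i⟩ hp
    have hj : j ≠ 0 := by
      simp only [Finset.mem_filter] at hp
      exact Fin.ne_zero_of_lt hp.2
    obtain ⟨j, rfl⟩ := Fin.exists_succ_eq.2 hj
    simp only [Finset.mem_filter, Finset.mem_univ, true_and, Fin.lt_def, Fin.val_castSucc,
      Fin.val_succ] at hp
    simp only [Fin.pred_succ, Fin.val_succ, Fin.val_castSucc, h i j (Fin.le_def.2 (by omega)),
      ← neg_smul]
    congr 1
    ring

variable (m : R →ₗ[k] R →ₗ[k] R) (l : R →ₗ[k] M →ₗ[k] M) (r : M →ₗ[k] R →ₗ[k] M)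

/-- The cofaces of the Hochschild complex. -/
def hochFace (n : ℕ) (i : Fin (n + 2)) : Cochain k R M n →ₗ[k] Cochain k R M (n + 1) :=
  Fin.cons (α := fun _ => Cochain k R M n →ₗ[k] Cochain k R M (n + 1)) (leftTerm l n)
    (Fin.snoc (α := fun _ => Cochain k R M n →ₗ[k] Cochain k R M (n + 1))
      (fun j : Fin n => midTerm m j) (rightTerm r n)) i

theorem hochFace_zero (n : ℕ) : hochFace m l r n 0 = leftTerm l n := rfl

theorem hochFace_mid {n : ℕ} (j : Fin n) : hochFace m l r n j.castSucc.succ = midTerm m j := by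
  simp [hochFace]

theorem hochFace_last (n : ℕ) : hochFace m l r n (Fin.last n).succ = rightTerm r n := by
  simp [hochFace]

theorem hochD_eq_sum_hochFace (n : ℕ) :
    hochD m l r n = ∑ i : Fin (n + 2), (-1 : k) ^ (i : ℕ) • hochFace m l r n i := by
  rw [Fin.sum_univ_succ, Fin.sum_univ_castSucc]
  simp [hochD, hochFace_zero, hochFace_mid, ← hochFace_last m l r, add_assoc]

variable {m l r} (hm : ∀ x y z, m (m x y) z = m x (m y z)) (hl : ∀ x y z, l (m x y) z = l x (l y z))
  (hlr : ∀ x y z, r (l x z) y = l x (r z y)) (hr : ∀ x y z, r (r z x) y = r z (m x y))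

include hm in
-- For i < j the two contracted pairs are disjoint; only i = j uses associativity.
theorem contractNth_contractNth {n : ℕ} {i j : Fin n} (hij : i ≤ j) (x : Fin (n + 2) → R) :
    Fin.contractNth i.castSucc (fun a b => m a b)
        (Fin.contractNth j.succ.castSucc (fun a b => m a b) x) =
      Fin.contractNth j.castSucc (fun a b => m a b)
        (Fin.contractNth i.castSucc.castSucc (fun a b => m a b) x) := by
  funext q
  obtain ⟨i, hi⟩ := i
  obtain ⟨j, hj⟩ := j
  obtain ⟨q, hq⟩ := q
  simp only [Fin.mk_le_mk] at hij
  simp only [Fin.contractNth, Fin.castSucc_mk, Fin.succ_mk]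
  grind

include hm hl hlr hr in
-- Each axiom enters once: `hl` for two faces at the left end, `hr` at the right end, `hlr` for one
-- at each end, `hm` for two inner faces. The other cases act on disjoint arguments.
theorem hochFace_comp {n : ℕ} (i j : Fin (n + 2)) (hij : i ≤ j) :
    hochFace m l r (n + 1) j.succ ∘ₗ hochFace m l r n i =
      hochFace m l r (n + 1) i.castSucc ∘ₗ hochFace m l r n j := by
  refine LinearMap.ext fun f => MultilinearMap.ext fun x => ?_
  rcases Fin.eq_zero_or_eq_succ i with rfl | ⟨i, rfl⟩
  · rcases Fin.eq_zero_or_eq_succ j with rfl | ⟨j, rfl⟩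
    · change hochFace m l r (n + 1) (0 : Fin (n + 1)).castSucc.succ _ x = _
      rw [hochFace_mid]
      exact hl _ _ _
    · induction j using Fin.lastCases with
      | last =>
        change hochFace m l r (n + 1) (Fin.last (n + 1)).succ _ x =
          leftTerm l (n + 1) (hochFace m l r n (Fin.last n).succ f) x
        rw [hochFace_last, hochFace_last]
        exact hlr _ _ _
      | cast j =>
        change hochFace m l r (n + 1) j.succ.castSucc.succ (leftTerm l n f) x =
          leftTerm l (n + 1) (hochFace m l r n j.castSucc.succ f) x
        rw [hochFace_mid, hochFace_mid, midTerm_apply, leftTerm_apply, leftTerm_apply,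
          midTerm_apply]
        congr 2
        · funext q
          simp [Fin.tail, Fin.contractNth]
  · obtain ⟨j, rfl⟩ : ∃ j', j = Fin.succ j' :=
      (Fin.eq_zero_or_eq_succ j).resolve_left (by rintro rfl; simp at hij)
    rw [Fin.succ_le_succ_iff] at hij
    induction j using Fin.lastCases with
    | last =>
      induction i using Fin.lastCases with
      | last =>
        change hochFace m l r (n + 1) (Fin.last (n + 1)).succ
            (hochFace m l r n (Fin.last n).succ f) x =
          hochFace m l r (n + 1) (Fin.last n).castSucc.succ (hochFace m l r n (Fin.last n).succ f) x
        rw [hochFace_last, hochFace_last, hochFace_mid, rightTerm_apply, rightTerm_apply,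
          midTerm_apply, rightTerm_apply, hr]
        congr 2
        · congr 1
          funext q
          simp [Fin.init, Fin.contractNth]
        · simp [Fin.contractNth, Fin.init]
      | cast i =>
        change hochFace m l r (n + 1) (Fin.last (n + 1)).succ
            (hochFace m l r n i.castSucc.succ f) x =
          hochFace m l r (n + 1) i.castSucc.castSucc.succ (hochFace m l r n (Fin.last n).succ f) x
        rw [hochFace_last, hochFace_last, hochFace_mid, hochFace_mid, rightTerm_apply,
          midTerm_apply, midTerm_apply, rightTerm_apply]
        congr 2
        have := i.isLt
        simp only [Fin.contractNth, Fin.val_last, Fin.val_castSucc, Fin.succ_last]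
        rw [if_neg (by omega), if_neg (by omega)]
    | cast j =>
      induction i using Fin.lastCases with
      | last => exact absurd hij (by simp)
      | cast i =>
        change hochFace m l r (n + 1) j.succ.castSucc.succ
            (hochFace m l r n i.castSucc.succ f) x =
          hochFace m l r (n + 1) i.castSucc.castSucc.succ (hochFace m l r n j.castSucc.succ f) x
        rw [hochFace_mid, hochFace_mid, hochFace_mid, hochFace_mid, midTerm_apply, midTerm_apply,
          midTerm_apply, midTerm_apply, contractNth_contractNth hm (by simpa using hij)]

include hm hl hlr hr in
theorem hochD_comp_hochD (n : ℕ) : hochD m l r (n + 1) ∘ₗ hochD m l r n = 0 := by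
  rw [hochD_eq_sum_hochFace, hochD_eq_sum_hochFace]
  exact alternating_coface_comp_eq_zero (C := fun n => Cochain k R M n) _ _
    (hochFace_comp hm hl hlr hr)

end Hochschild

/-! ### Non-empty subsets of positions -/

theorem Fin.predAbove_succ_succAbove {n : ℕ} (i j : Fin n) :
    i.predAbove (i.succ.succAbove j) = j := by
  rcases lt_or_ge i j with h | h
  · rw [Fin.succAbove_of_le_castSucc _ _ (by simpa [Fin.le_def] using h),
      Fin.predAbove_of_castSucc_lt _ _ (by rw [Fin.lt_def] at *; simp; omega), Fin.pred_succ]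
  · rw [Fin.succAbove_of_castSucc_lt _ _ (by rw [Fin.lt_def]; rw [Fin.le_def] at h; simp; omega),
      Fin.predAbove_of_le_castSucc _ _ (by simpa using h), Fin.castPred_castSucc]

/-- The subset `{p}`. -/
def NESubset.single {n : ℕ} (p : Fin n) : NESubset n := ⟨{p}, Finset.singleton_nonempty p⟩

/-- The image of `J` under the embedding of positions that omits `p`. -/
def NESubset.shift {n : ℕ} (p : Fin (n + 1)) (J : NESubset n) : NESubset (n + 1) :=
  ⟨J.1.map p.succAboveEmb, J.2.map⟩

/-- The image of `J` under the embedding of positions that omits `p`, together with `p`. -/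
def NESubset.adjoin {n : ℕ} (p : Fin (n + 1)) (J : NESubset n) : NESubset (n + 1) :=
  ⟨insert p (J.1.map p.succAboveEmb), Finset.insert_nonempty _ _⟩

theorem NESubset.self_notMem_shift {n : ℕ} (p : Fin (n + 1)) (J : NESubset n) :
    p ∉ (J.shift p).1 := by
  simp [NESubset.shift, Fin.succAbove_ne]

theorem NESubset.succAbove_mem_shift {n : ℕ} (p : Fin (n + 1)) (J : NESubset n) (j : Fin n) :
    p.succAbove j ∈ (J.shift p).1 ↔ j ∈ J.1 := by
  simp [NESubset.shift]

theorem NESubset.self_mem_adjoin {n : ℕ} (p : Fin (n + 1)) (J : NESubset n) :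
    p ∈ (J.adjoin p).1 := by
  simp [NESubset.adjoin]

theorem NESubset.succAbove_mem_adjoin {n : ℕ} (p : Fin (n + 1)) (J : NESubset n) (j : Fin n) :
    p.succAbove j ∈ (J.adjoin p).1 ↔ j ∈ J.1 := by
  simp [NESubset.adjoin, Fin.succAbove_ne]

theorem NESubset.succAbove_notMem_single {n : ℕ} (p : Fin (n + 1)) (j : Fin n) :
    p.succAbove j ∉ (NESubset.single p).1 := by
  simp [NESubset.single, Fin.succAbove_ne]

theorem NESubset.ext_succAbove {n : ℕ} (p : Fin (n + 1)) {I I' : NESubset (n + 1)}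
    (hp : p ∈ I.1 ↔ p ∈ I'.1) (h : ∀ j, p.succAbove j ∈ I.1 ↔ p.succAbove j ∈ I'.1) : I = I' := by
  refine Subtype.ext (Finset.ext fun q => ?_)
  rcases Fin.eq_self_or_eq_succAbove p q with rfl | ⟨j, rfl⟩
  exacts [hp, h j]

/-- Removing p from a set leaves either nothing or a non-empty J, and in the latter case p may or
may not have belonged to the set. -/
theorem NESubset.sum_succ {n : ℕ} {V : Type*} [AddCommMonoid V] (p : Fin (n + 1))
    (F : NESubset (n + 1) → V) :
    ∑ I, F I = F (.single p) + (∑ J : NESubset n, F (J.shift p) + ∑ J : NESubset n, F (J.adjoin p)) := by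
  let e : Unit ⊕ (NESubset n ⊕ NESubset n) → NESubset (n + 1) :=
    Sum.elim (fun _ => .single p) (Sum.elim (NESubset.shift p) (NESubset.adjoin p))
  have he : Function.Bijective e := by
    constructor
    · have key : ∀ I : NESubset (n + 1), ∀ J : NESubset n,
          (∀ j, p.succAbove j ∉ I.1) → (∀ j, p.succAbove j ∈ I.1 ↔ j ∈ J.1) → False := by
        rintro I ⟨J, j, hj⟩ h h'
        exact h j ((h' j).2 hj)
      have inj : ∀ (I : NESubset (n + 1)) (J J' : NESubset n),
          (∀ j, p.succAbove j ∈ I.1 ↔ j ∈ J.1) → (∀ j, p.succAbove j ∈ I.1 ↔ j ∈ J'.1) → J = J' :=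
        fun I J J' h h' => Subtype.ext (Finset.ext fun j => (h j).symm.trans (h' j))
      rintro (⟨⟩ | J | J) (⟨⟩ | J' | J') h <;> simp only [e, Sum.elim_inl, Sum.elim_inr] at h
      · rfl
      · exact (key _ J' (NESubset.succAbove_notMem_single p) (h ▸ J'.succAbove_mem_shift p)).elim
      · exact (key _ J' (NESubset.succAbove_notMem_single p) (h ▸ J'.succAbove_mem_adjoin p)).elim
      · exact (key _ J (NESubset.succAbove_notMem_single p) (h ▸ J.succAbove_mem_shift p)).elim
      · rw [inj _ J J' (J.succAbove_mem_shift p) (h ▸ J'.succAbove_mem_shift p)]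
      · exact (J.self_notMem_shift p (h ▸ J'.self_mem_adjoin p)).elim
      · exact (key _ J (NESubset.succAbove_notMem_single p) (h ▸ J.succAbove_mem_adjoin p)).elim
      · exact (J'.self_notMem_shift p (h ▸ J.self_mem_adjoin p)).elim
      · rw [inj _ J J' (J.succAbove_mem_adjoin p) (h ▸ J'.succAbove_mem_adjoin p)]
    · intro I
      by_cases hJ : ∃ j, p.succAbove j ∈ I.1
      · let J : NESubset n := ⟨Finset.univ.filter fun j => p.succAbove j ∈ I.1, by
          obtain ⟨j, hj⟩ := hJ
          exact ⟨j, by simpa using hj⟩⟩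
        by_cases hp : p ∈ I.1
        · refine ⟨.inr (.inr J), NESubset.ext_succAbove p ?_ fun j => ?_⟩
          · simp [e, hp, J.self_mem_adjoin]
          · simp [e, J.succAbove_mem_adjoin, J]
        · refine ⟨.inr (.inl J), NESubset.ext_succAbove p ?_ fun j => ?_⟩
          · simp [e, hp, J.self_notMem_shift]
          · simp [e, J.succAbove_mem_shift, J]
      · push Not at hJ
        have hp : p ∈ I.1 := by
          obtain ⟨q, hq⟩ := I.2
          rcases Fin.eq_self_or_eq_succAbove p q with rfl | ⟨j, rfl⟩
          exacts [hq, (hJ j hq).elim]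
        refine ⟨.inl (), NESubset.ext_succAbove p ?_ fun j => ?_⟩
        · simp [e, hp, NESubset.single]
        · simp [e, NESubset.succAbove_notMem_single, hJ j]
  rw [← he.sum_comp]
  simp [e]

theorem mem_mergeSet {n : ℕ} (i j : Fin n) (I : NESubset (n + 1)) :
    j ∈ (mergeSet i I).1 ↔ i.succ.succAbove j ∈ I.1 ∨ (j = i ∧ i.succ ∈ I.1) := by
  simp only [mergeSet, Finset.mem_image]
  constructor
  · rintro ⟨q, hq, rfl⟩
    rcases Fin.eq_self_or_eq_succAbove i.succ q with rfl | ⟨j, rfl⟩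
    · exact Or.inr ⟨Fin.predAbove_succ_self _, hq⟩
    · rw [Fin.predAbove_succ_succAbove]
      exact Or.inl hq
  · rintro (h | ⟨rfl, h⟩)
    · exact ⟨_, h, Fin.predAbove_succ_succAbove _ _⟩
    · exact ⟨_, h, Fin.predAbove_succ_self _⟩

theorem self_mem_mergeSet {n : ℕ} (i : Fin n) (I : NESubset (n + 1)) :
    i ∈ (mergeSet i I).1 ↔ i.castSucc ∈ I.1 ∨ i.succ ∈ I.1 := by
  rw [mem_mergeSet, Fin.succAbove_of_castSucc_lt _ _ (Fin.castSucc_lt_succ)]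
  simp

theorem mem_mergeSet_of_ne {n : ℕ} {i j : Fin n} (h : j ≠ i) (I : NESubset (n + 1)) :
    j ∈ (mergeSet i I).1 ↔ i.succ.succAbove j ∈ I.1 := by
  simp [mem_mergeSet, h]

/-- The preimage of `J` under the map that merges positions `i` and `i + 1`. -/
def NESubset.unmerge {n : ℕ} (i : Fin n) (J : NESubset n) : NESubset (n + 1) :=
  ⟨Finset.univ.filter fun q => i.predAbove q ∈ J.1, by
    obtain ⟨j, hj⟩ := J.2
    exact ⟨i.succ.succAbove j, by simpa [Fin.predAbove_succ_succAbove] using hj⟩⟩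

theorem mergeSet_unmerge {n : ℕ} (i : Fin n) (J : NESubset n) : mergeSet i (J.unmerge i) = J := by
  refine Subtype.ext (Finset.ext fun j => ?_)
  simp only [mem_mergeSet, NESubset.unmerge, Finset.mem_filter, Finset.mem_univ, true_and,
    Fin.predAbove_succ_succAbove, Fin.predAbove_succ_self]
  grind

theorem mergeSet_shift_succ {n : ℕ} (i : Fin n) (J : NESubset n) :
    mergeSet i (J.shift i.succ) = J := by
  refine Subtype.ext (Finset.ext fun j => ?_)
  simp [mem_mergeSet, NESubset.succAbove_mem_shift, NESubset.self_notMem_shift]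

theorem mergeSet_shift_castSucc {n : ℕ} (i : Fin n) (J : NESubset n) :
    mergeSet i (J.shift i.castSucc) = J := by
  refine Subtype.ext ?_
  simp only [mergeSet, NESubset.shift, Finset.map_eq_image, Finset.image_image]
  rw [show i.predAbove ∘ i.castSucc.succAboveEmb = id from
    funext fun j => Fin.predAbove_succAbove i j, Finset.image_id]

/-- On the sets satisfying p, merging is a bijection with inverse e. It is applied to the three
conditions on I at i and i + 1 that go with ≺, ≻ and ·. -/
theorem sum_mergeSet {n : ℕ} {V : Type*} [AddCommMonoid V] (i : Fin n) (G : NESubset n → V)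
    (p : NESubset (n + 1) → Prop) [DecidablePred p] (e : NESubset n → NESubset (n + 1))
    (he : ∀ J, p (e J)) (hme : ∀ J, mergeSet i (e J) = J)
    (hinj : ∀ I I', p I → p I' → mergeSet i I = mergeSet i I' → I = I') :
    ∑ I, (if p I then G (mergeSet i I) else 0) = ∑ J, G J := by
  rw [← Finset.sum_filter]
  refine Finset.sum_nbij' (mergeSet i) e (by simp) (by simpa using he) ?_ (by simpa using hme)
    (by simp)
  intro I hI
  exact hinj _ _ (he _) (by simpa using hI) (hme _)

/-- Merging loses information only at the positions i and i + 1. -/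
theorem eq_of_mergeSet_eq {n : ℕ} {i : Fin n} {I I' : NESubset (n + 1)}
    (h : mergeSet i I = mergeSet i I') (h1 : i.castSucc ∈ I.1 ↔ i.castSucc ∈ I'.1)
    (h2 : i.succ ∈ I.1 ↔ i.succ ∈ I'.1) : I = I' := by
  refine NESubset.ext_succAbove i.succ h2 fun j => ?_
  by_cases hj : j = i
  · subst hj
    rwa [Fin.succAbove_of_castSucc_lt _ _ (Fin.castSucc_lt_succ)]
  · rw [← mem_mergeSet_of_ne hj, ← mem_mergeSet_of_ne hj, h]

theorem sum_mergeSet_succ_notMem {n : ℕ} {V : Type*} [AddCommMonoid V] (i : Fin n)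
    (G : NESubset n → V) :
    ∑ I : NESubset (n + 1), (if i.succ ∉ I.1 then G (mergeSet i I) else 0) = ∑ J, G J := by
  refine sum_mergeSet i G (fun I => i.succ ∉ I.1) (NESubset.shift i.succ)
    (NESubset.self_notMem_shift _) (mergeSet_shift_succ i) fun I I' h h' hm => ?_
  have := congrArg (fun J : NESubset n => i ∈ J.1) hm
  simp only [self_mem_mergeSet, eq_iff_iff] at this
  exact eq_of_mergeSet_eq hm (by tauto) (by tauto)

theorem sum_mergeSet_castSucc_notMem {n : ℕ} {V : Type*} [AddCommMonoid V] (i : Fin n)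
    (G : NESubset n → V) :
    ∑ I : NESubset (n + 1), (if i.castSucc ∉ I.1 then G (mergeSet i I) else 0) = ∑ J, G J := by
  refine sum_mergeSet i G (fun I => i.castSucc ∉ I.1) (NESubset.shift i.castSucc)
    (NESubset.self_notMem_shift _) (mergeSet_shift_castSucc i) fun I I' h h' hm => ?_
  have := congrArg (fun J : NESubset n => i ∈ J.1) hm
  simp only [self_mem_mergeSet, eq_iff_iff] at this
  exact eq_of_mergeSet_eq hm (by tauto) (by tauto)

theorem sum_mergeSet_iff {n : ℕ} {V : Type*} [AddCommMonoid V] (i : Fin n)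
    (G : NESubset n → V) :
    ∑ I : NESubset (n + 1), (if i.castSucc ∈ I.1 ↔ i.succ ∈ I.1 then G (mergeSet i I) else 0) =
      ∑ J, G J := by
  refine sum_mergeSet i G (fun I => i.castSucc ∈ I.1 ↔ i.succ ∈ I.1) (NESubset.unmerge i)
    (fun J => by simp [NESubset.unmerge]) (mergeSet_unmerge i) fun I I' h h' hm => ?_
  have := congrArg (fun J : NESubset n => i ∈ J.1) hm
  simp only [self_mem_mergeSet, eq_iff_iff] at this
  exact eq_of_mergeSet_eq hm (by tauto) (by tauto)

/-! ### Identities between the monomials `P(a₁, …, aₙ; I)` -/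

theorem Fin.prod_contractNth {T : Type*} [CommMonoid T] {n : ℕ} (i : Fin n) (F : Fin (n + 1) → T) :
    ∏ j, Fin.contractNth i.castSucc (· * ·) F j = ∏ j, F j := by
  rw [Fin.prod_univ_succAbove F i.succ]
  have : ∀ j, Fin.contractNth i.castSucc (· * ·) F j =
      (if j = i then F i.succ else 1) * F (i.succ.succAbove j) := by
    intro j
    rcases lt_trichotomy j i with h | rfl | h
    · rw [Fin.contractNth_apply_of_lt _ _ _ _ (by simpa using h), if_neg h.ne, one_mul,
        Fin.succAbove_of_castSucc_lt _ _ (Fin.castSucc_lt_succ_iff.2 h.le)]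
    · rw [Fin.contractNth_apply_of_eq _ _ _ _ (by simp), if_pos rfl,
        Fin.succAbove_of_castSucc_lt _ _ Fin.castSucc_lt_succ, mul_comm]
    · rw [Fin.contractNth_apply_of_gt _ _ _ _ (by simpa using h), if_neg h.ne', one_mul,
        Fin.succAbove_of_le_castSucc _ _ (Fin.succ_le_castSucc_iff.2 h)]
  rw [Finset.prod_congr rfl fun j _ => this j, Finset.prod_mul_distrib]
  simp

/-- Away from i the factors are merely renumbered, so the products agree as soon as the merged
factor splits, which is `h`. -/
theorem prod_contractNth_mergeSet {k A T : Type*} [Field k] [AddCommGroup A] [Module k A]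
    [CommRing T] [Algebra k T] {u v : A →ₗ[k] T} {n : ℕ}
    (i : Fin n) (I : NESubset (n + 1)) (op : A → A → A) (a : Fin (n + 1) → A)
    (h : (if i.castSucc ∈ I.1 ∨ i.succ ∈ I.1 then u else v) (op (a i.castSucc) (a i.succ)) =
      (if i.castSucc ∈ I.1 then u else v) (a i.castSucc) *
        (if i.succ ∈ I.1 then u else v) (a i.succ)) :
    ∏ j, (if j ∈ (mergeSet i I).1 then u else v) (Fin.contractNth i.castSucc op a j) =
      ∏ j, (if j ∈ I.1 then u else v) (a j) := by
  rw [← Fin.prod_contractNth i]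
  refine Finset.prod_congr rfl fun j _ => ?_
  rcases lt_trichotomy j i with h' | rfl | h'
  · rw [Fin.contractNth_apply_of_lt _ _ _ _ (by simpa using h'),
      Fin.contractNth_apply_of_lt _ _ _ _ (by simpa using h')]
    simp only [mem_mergeSet_of_ne h'.ne,
      Fin.succAbove_of_castSucc_lt _ _ (Fin.castSucc_lt_succ_iff.2 h'.le)]
  · rw [Fin.contractNth_apply_of_eq _ _ _ _ (by simp), Fin.contractNth_apply_of_eq _ _ _ _ (by simp)]
    simpa only [self_mem_mergeSet] using h
  · rw [Fin.contractNth_apply_of_gt _ _ _ _ (by simpa using h'),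
      Fin.contractNth_apply_of_gt _ _ _ _ (by simpa using h')]
    simp only [mem_mergeSet_of_ne h'.ne',
      Fin.succAbove_of_le_castSucc _ _ (Fin.succ_le_castSucc_iff.2 h')]

namespace CommTriAlgebra

variable {k : Type*} {A : Type*} [Field k] [AddCommGroup A] [Module k A] [CommTriAlgebra k A]

/-- Since v is multiplicative for both products, v(P(J)) is the product of all v(a_j) whatever J is.
-/
theorem ast_monomialP {n : ℕ} (a : Fin (n + 1) → A) (p : Fin (n + 1)) (J : NESubset n) :
    ast (k := k) (a p) (monomialP k (fun j => a (p.succAbove j)) J.1) =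
      monomialP k a (NESubset.single p).1 := by
  obtain ⟨T, _, _, u, v, hu, hb, ha, hv', hv⟩ := exists_embedding k A
  have hvP : v (monomialP k (fun j => a (p.succAbove j)) J.1) = ∏ j, v (a (p.succAbove j)) := by
    -- `map_monomialP` is used with v in both roles.
    rw [map_monomialP (u := v) (v := v) hv' hv hv _ J.2]
    simp
  refine hu ?_
  rw [ha, hvP, map_monomialP hb ha hv _ (NESubset.single p).2, Fin.prod_univ_succAbove _ p]
  simp [NESubset.succAbove_notMem_single, show p ∈ (NESubset.single p).1 by simp [NESubset.single]]

theorem monomialP_ast {n : ℕ} (a : Fin (n + 1) → A) (p : Fin (n + 1)) (J : NESubset n) :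
    ast (k := k) (monomialP k (fun j => a (p.succAbove j)) J.1) (a p) =
      monomialP k a (J.shift p).1 := by
  obtain ⟨T, _, _, u, v, hu, hb, ha, hv', hv⟩ := exists_embedding k A
  refine hu ?_
  rw [ha, map_monomialP hb ha hv _ J.2, map_monomialP hb ha hv _ (J.shift p).2,
    Fin.prod_univ_succAbove _ p, mul_comm]
  simp only [NESubset.succAbove_mem_shift, NESubset.self_notMem_shift, if_false]

theorem bul_monomialP {n : ℕ} (a : Fin (n + 1) → A) (p : Fin (n + 1)) (J : NESubset n) :
    bul (k := k) (a p) (monomialP k (fun j => a (p.succAbove j)) J.1) =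
      monomialP k a (J.adjoin p).1 := by
  obtain ⟨T, _, _, u, v, hu, hb, ha, hv', hv⟩ := exists_embedding k A
  refine hu ?_
  rw [hb, map_monomialP hb ha hv _ J.2, map_monomialP hb ha hv _ (J.adjoin p).2,
    Fin.prod_univ_succAbove _ p]
  simp only [NESubset.succAbove_mem_adjoin, NESubset.self_mem_adjoin, if_true]

/-- Both u and v send x ∗ y to a product whose second factor is v(y), so the right-hand position
must lie outside I. -/
theorem monomialP_contractNth_ast {n : ℕ} (a : Fin (n + 1) → A) (i : Fin n) (I : NESubset (n + 1))
    (h : i.succ ∉ I.1) :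
    monomialP k (Fin.contractNth i.castSucc (fun x y => ast (k := k) x y) a) (mergeSet i I).1 =
      monomialP k a I.1 := by
  obtain ⟨T, _, _, u, v, hu, hb, ha, hv', hv⟩ := exists_embedding k A
  refine hu ?_
  rw [map_monomialP hb ha hv _ (mergeSet i I).2, map_monomialP hb ha hv _ I.2]
  refine prod_contractNth_mergeSet i I _ a ?_
  by_cases h' : i.castSucc ∈ I.1 <;> simp [h, h', ha, hv]

theorem monomialP_contractNth_ast_flip {n : ℕ} (a : Fin (n + 1) → A) (i : Fin n)
    (I : NESubset (n + 1)) (h : i.castSucc ∉ I.1) :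
    monomialP k (Fin.contractNth i.castSucc (fun x y => ast (k := k) y x) a) (mergeSet i I).1 =
      monomialP k a I.1 := by
  obtain ⟨T, _, _, u, v, hu, hb, ha, hv', hv⟩ := exists_embedding k A
  refine hu ?_
  rw [map_monomialP hb ha hv _ (mergeSet i I).2, map_monomialP hb ha hv _ I.2]
  refine prod_contractNth_mergeSet i I _ a ?_
  by_cases h' : i.succ ∈ I.1 <;> simp [h, h', ha, hv, mul_comm]

theorem monomialP_contractNth_bul {n : ℕ} (a : Fin (n + 1) → A) (i : Fin n)
    (I : NESubset (n + 1)) (h : i.castSucc ∈ I.1 ↔ i.succ ∈ I.1) :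
    monomialP k (Fin.contractNth i.castSucc (fun x y => bul (k := k) x y) a) (mergeSet i I).1 =
      monomialP k a I.1 := by
  obtain ⟨T, _, _, u, v, hu, hb, ha, hv', hv⟩ := exists_embedding k A
  refine hu ?_
  rw [map_monomialP hb ha hv _ (mergeSet i I).2, map_monomialP hb ha hv _ I.2]
  refine prod_contractNth_mergeSet i I _ a ?_
  by_cases h' : i.succ ∈ I.1 <;> simp [h, h', hb, hv']

end CommTriAlgebra

/-! ### The comparison map is a cochain map -/

/-- Contracting with a sum of operations, inside a multilinear map. -/
theorem MultilinearMap.map_contract_add {k R M : Type*} [Field k] [AddCommGroup R] [Module k R]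
    [AddCommGroup M] [Module k M] {n : ℕ} (f : MultilinearMap k (fun _ : Fin n => R) M) {i : Fin n}
    {x y z w : Fin n → R} (hx : ∀ j ≠ i, x j = w j) (hy : ∀ j ≠ i, y j = w j)
    (hz : ∀ j ≠ i, z j = w j) (hi : w i = x i + y i + z i) : f w = f x + f y + f z := by
  have e : ∀ t : Fin n → R, (∀ j ≠ i, t j = w j) → t = Function.update w i (t i) := fun t ht =>
    (Function.eq_update_iff.2 ⟨rfl, ht⟩)
  rw [e x hx, e y hy, e z hz, ← f.map_update_add, ← f.map_update_add]
  simp only [← hi, Function.update_eq_self]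

section CochainMap

variable {k A B N : Type*} [Field k] [AddCommGroup A] [Module k A] [CommTriAlgebra k A]
  [AddCommGroup B] [Module k B] [TriDendriform k B]
  [AddCommGroup N] [Module k N]

open CommTriAlgebra TriDendriform TriDendModule

theorem contractNth_apply_ne {R : Type*} (op op' : R → R → R) {n : ℕ} (i : Fin n)
    (x : Fin (n + 1) → R) {j : Fin n} (h : j ≠ i) :
    Fin.contractNth i.castSucc op x j = Fin.contractNth i.castSucc op' x j := by
  have : (i.castSucc : ℕ) ≠ j := fun e => h (Fin.ext e.symm)
  rw [Fin.contractNth_apply_of_ne _ _ _ _ this, Fin.contractNth_apply_of_ne _ _ _ _ this]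

theorem comparison_contractNth {n : ℕ} (g : TriCochain k B N n) (a : Fin (n + 1) → A)
    (b : Fin (n + 1) → B) (i : Fin n) :
    comparison k A B N n g (Fin.contractNth i.castSucc (fun x y => tensorMul k A B x y)
        (fun j => a j ⊗ₜ[k] b j)) =
      ∑ I : NESubset (n + 1), monomialP k a I.1 ⊗ₜ[k]
        g (mergeSet i I) (Fin.contractNth i.castSucc (fun x y => mergeOp k B i I x y) b) := by
  have split := MultilinearMap.map_contract_add (comparison k A B N n g) (i := i)
    (w := Fin.contractNth i.castSucc (fun x y => tensorMul k A B x y) (fun j => a j ⊗ₜ[k] b j))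
    (x := fun j => Fin.contractNth i.castSucc (fun x y => ast (k := k) x y) a j ⊗ₜ[k]
      Fin.contractNth i.castSucc (fun x y => prec (k := k) x y) b j)
    (y := fun j => Fin.contractNth i.castSucc (fun x y => ast (k := k) y x) a j ⊗ₜ[k]
      Fin.contractNth i.castSucc (fun x y => succ (k := k) x y) b j)
    (z := fun j => Fin.contractNth i.castSucc (fun x y => bul (k := k) x y) a j ⊗ₜ[k]
      Fin.contractNth i.castSucc (fun x y => dot (k := k) x y) b j)
  have aux : ∀ (op : A → A → A) (op' : B → B → B), ∀ j ≠ i,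
      Fin.contractNth i.castSucc op a j ⊗ₜ[k] Fin.contractNth i.castSucc op' b j =
        Fin.contractNth i.castSucc (fun x y => tensorMul k A B x y) (fun j => a j ⊗ₜ[k] b j) j := by
    intro op op' j hj
    have : (i.castSucc : ℕ) ≠ j := fun e => hj (Fin.ext e.symm)
    simp only [Fin.contractNth_apply_of_ne _ _ _ _ this]
  rw [split (aux _ _) (aux _ _) (aux _ _) (by
    simp only [Fin.contractNth_apply_of_eq i.castSucc _ _ i rfl]
    simp [tensorMul])]
  simp only [comparison_tmul]
  -- The three sums over J become sums over sets I of n + 1 positions, each restricted by its own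
  -- condition at i and i + 1.
  rw [← sum_mergeSet_succ_notMem i, ← sum_mergeSet_castSucc_notMem i, ← sum_mergeSet_iff i,
    ← Finset.sum_add_distrib, ← Finset.sum_add_distrib]
  refine Finset.sum_congr rfl fun I _ => ?_
  have total_split : ∀ f : Cochain k B N n,
      f (Fin.contractNth i.castSucc (fun x y => total k B x y) b) =
        f (Fin.contractNth i.castSucc (fun x y => prec (k := k) x y) b) +
        f (Fin.contractNth i.castSucc (fun x y => succ (k := k) x y) b) +
        f (Fin.contractNth i.castSucc (fun x y => dot (k := k) x y) b) := fun f =>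
    f.map_contract_add (i := i) (fun j hj => contractNth_apply_ne _ _ i b hj)
      (fun j hj => contractNth_apply_ne _ _ i b hj) (fun j hj => contractNth_apply_ne _ _ i b hj) (by
        simp only [Fin.contractNth_apply_of_eq i.castSucc _ _ i rfl]; rfl)
  -- A set meeting {i, i + 1} satisfies exactly one of the conditions; one that misses it satisfies
  -- all three, and the terms add up to ∘.
  by_cases h1 : i.castSucc ∈ I.1 <;> by_cases h2 : i.succ ∈ I.1
  · simp [h1, h2, mergeOp, monomialP_contractNth_bul]
  · simp [h1, h2, mergeOp, monomialP_contractNth_ast]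
  · simp [h1, h2, mergeOp, monomialP_contractNth_ast_flip]
  · simp [h1, h2, mergeOp, monomialP_contractNth_ast_flip, monomialP_contractNth_ast,
      monomialP_contractNth_bul, total_split, TensorProduct.tmul_add]

variable [TriDendModule k B N]

theorem triLeft_apply {n : ℕ} (g : TriCochain k B N n) (b : Fin (n + 1) → B)
    {I : NESubset (n + 1)} {J : NESubset n} (h : ∀ j : Fin n, j.succ ∈ I.1 ↔ j ∈ J.1) :
    triLeft k B N n I g b = (if 0 ∈ I.1 then ldot (k := k) else lsucc) (b 0) (g J (Fin.tail b)) := by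
  have hJ : tailSet I.1 = J.1 := by ext j; simp [tailSet, h]
  have hJ' : (tailSet I.1).Nonempty := hJ ▸ J.2
  rw [triLeft, dif_pos hJ', show (⟨tailSet I.1, hJ'⟩ : NESubset n) = J from Subtype.ext hJ]
  rfl

theorem triLeft_single {n : ℕ} (g : TriCochain k B N n) (b : Fin (n + 1) → B) :
    triLeft k B N n (.single 0) g b = ∑ J, lprec (k := k) (b 0) (g J (Fin.tail b)) := by
  rw [triLeft, dif_neg (by simp [tailSet, NESubset.single])]
  simp [leftTerm_apply]

theorem triRight_apply {n : ℕ} (g : TriCochain k B N n) (b : Fin (n + 1) → B)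
    {I : NESubset (n + 1)} {J : NESubset n} (h : ∀ j : Fin n, j.castSucc ∈ I.1 ↔ j ∈ J.1) :
    triRight k B N n I g b =
      (if Fin.last n ∈ I.1 then rdot (k := k) else rprec) (g J (Fin.init b)) (b (Fin.last n)) := by
  have hJ : initSet I.1 = J.1 := by ext j; simp [initSet, h]
  have hJ' : (initSet I.1).Nonempty := hJ ▸ J.2
  rw [triRight, dif_pos hJ', show (⟨initSet I.1, hJ'⟩ : NESubset n) = J from Subtype.ext hJ]
  rfl

theorem triRight_single {n : ℕ} (g : TriCochain k B N n) (b : Fin (n + 1) → B) :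
    triRight k B N n (.single (Fin.last n)) g b =
      ∑ J, rsucc (k := k) (g J (Fin.init b)) (b (Fin.last n)) := by
  rw [triRight, dif_neg (by simp [initSet, NESubset.single, Fin.castSucc_ne_last])]
  simp [rightTerm_apply]

theorem tensorLeft_comparison {n : ℕ} (g : TriCochain k B N n) (a : Fin (n + 1) → A)
    (b : Fin (n + 1) → B) :
    tensorLeft k A B N (a 0 ⊗ₜ[k] b 0)
        (comparison k A B N n g (Fin.tail fun j => a j ⊗ₜ[k] b j)) =
      ∑ I : NESubset (n + 1), monomialP k a I.1 ⊗ₜ[k] triLeft k B N n I g b := by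
  have e := comparison_tmul g (fun j : Fin n => a ((0 : Fin (n + 1)).succAbove j)) (Fin.tail b)
  have e' : (Fin.tail fun j => a j ⊗ₜ[k] b j) = fun j : Fin n =>
    a ((0 : Fin (n + 1)).succAbove j) ⊗ₜ[k] Fin.tail b j := rfl
  have h1 (J : NESubset n) := triLeft_apply g b (I := J.shift 0) (J := J)
    fun j => J.succAbove_mem_shift 0 j
  have h2 (J : NESubset n) := triLeft_apply g b (I := J.adjoin 0) (J := J)
    fun j => J.succAbove_mem_adjoin 0 j
  simp only [NESubset.self_notMem_shift, NESubset.self_mem_adjoin, if_true, if_false] at h1 h2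
  rw [e', e, NESubset.sum_succ 0, triLeft_single]
  simp only [h1, h2, map_sum, TensorProduct.tmul_sum, ← Finset.sum_add_distrib]
  refine Finset.sum_congr rfl fun J _ => ?_
  -- Here ≺, ≻, · feed the sets {0}, J and J ∪ {0}; at the right end ≺ and ≻ exchange roles.
  rw [← ast_monomialP a 0 J, ← monomialP_ast a 0 J, ← bul_monomialP a 0 J]
  simp [tensorLeft, add_assoc]

theorem tensorRight_comparison {n : ℕ} (g : TriCochain k B N n) (a : Fin (n + 1) → A)
    (b : Fin (n + 1) → B) :
    tensorRight k A B N (comparison k A B N n g (Fin.init fun j => a j ⊗ₜ[k] b j))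
        (a (Fin.last n) ⊗ₜ[k] b (Fin.last n)) =
      ∑ I : NESubset (n + 1), monomialP k a I.1 ⊗ₜ[k] triRight k B N n I g b := by
  have e := comparison_tmul g (fun j : Fin n => a ((Fin.last n).succAbove j)) (Fin.init b)
  have e' : (Fin.init fun j => a j ⊗ₜ[k] b j) = fun j : Fin n =>
      a ((Fin.last n).succAbove j) ⊗ₜ[k] Fin.init b j := by
    funext j
    simp [Fin.init]
  have h1 (J : NESubset n) := triRight_apply g b (I := J.shift (Fin.last n)) (J := J)
    fun j => by rw [← J.succAbove_mem_shift (Fin.last n) j, Fin.succAbove_last_apply]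
  have h2 (J : NESubset n) := triRight_apply g b (I := J.adjoin (Fin.last n)) (J := J)
    fun j => by rw [← J.succAbove_mem_adjoin (Fin.last n) j, Fin.succAbove_last_apply]
  simp only [NESubset.self_notMem_shift, NESubset.self_mem_adjoin, if_true, if_false] at h1 h2
  rw [e', e, NESubset.sum_succ (Fin.last n), triRight_single]
  simp only [h1, h2, map_sum, LinearMap.sum_apply, TensorProduct.tmul_sum,
    ← Finset.sum_add_distrib]
  refine Finset.sum_congr rfl fun J _ => ?_
  rw [← ast_monomialP a _ J, ← monomialP_ast a _ J, ← bul_monomialP a _ J, bul_comm (a _)]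
  simp [tensorRight]
  abel

theorem tensorHochD_comparison (n : ℕ) (g : TriCochain k B N n) :
    tensorHochD k A B N n (comparison k A B N n g) =
      comparison k A B N (n + 1) (triD k B N n g) := by
  refine MultilinearMap.ext_tmul fun a b => ?_
  rw [comparison_tmul]
  simp only [tensorHochD, hochD, triD, LinearMap.add_apply, LinearMap.sum_apply,
    LinearMap.smul_apply, _root_.add_apply, _root_.smul_apply,
    _root_.sum_apply, LinearMap.pi_apply, leftTerm_apply, rightTerm_apply, midTerm_apply,
    tensorLeft_comparison, tensorRight_comparison, comparison_contractNth, LinearMap.comp_apply,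
    LinearMap.proj_apply, TensorProduct.tmul_add, TensorProduct.tmul_sum, TensorProduct.tmul_smul,
    Finset.sum_add_distrib, Finset.smul_sum]
  -- The inner terms are summed over i and I in opposite orders.
  rw [Finset.sum_comm]

end CochainMap

/-! ### Injectivity of the comparison map -/

/-- A commutative algebra with an idempotent endomorphism `f` is a commutative tri-algebra with
`x ∗ y = x * f y` and `x • y = x * y`. -/
abbrev CommTriAlgebra.ofIdempotent {k S : Type*} [Field k] [CommRing S] [Algebra k S] (f : S →ₐ[k] S)
    (hf : ∀ x, f (f x) = f x) : CommTriAlgebra k S where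
  ast := (LinearMap.mul k S).compl₂ f.toLinearMap
  bul := LinearMap.mul k S
  ast_assoc x y z := by simp [hf, mul_assoc]
  ast_perm x y z := by simp [hf, mul_comm]
  bul_comm x y := by simp [mul_comm]
  bul_assoc x y z := by simp [mul_assoc]
  ast_bul x y z := by simp [hf]
  bul_ast x y z := by simp [mul_assoc]

/-- Uniqueness of binary expansions. -/
theorem Finset.sum_two_pow_injective (n : ℕ) :
    Function.Injective fun I : Finset (Fin n) => ∑ j ∈ I, 2 ^ (j : ℕ) := by
  intro I I' h
  refine Finset.map_injective Fin.valEmbedding (Finset.equivBitIndices.symm.injective ?_)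
  simpa [Finset.equivBitIndices] using h

namespace CommTriAlgebra

/-- In a free commutative tri-algebra on a non-empty set, there are elements `a₁, …, aₙ` whose
monomials `P(a₁, …, aₙ; I)` are linearly independent. -/
theorem IsFree.exists_linearIndependent.{u, v, w} {k : Type u} {X : Type v} {A : Type w} [Field k]
    [Nonempty X] [AddCommGroup A] [Module k A] [CommTriAlgebra k A] {ι : X → A}
    (hA : IsFree k ι) (n : ℕ) :
    ∃ a : Fin n → A, LinearIndependent k fun I : NESubset n => monomialP k a I.1 := by
  -- The lift places k[s, t] in the universe over which `IsFree` quantifies.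
  let σ := ULift.{max v w} Bool
  let S := MvPolynomial σ k
  let s : S := MvPolynomial.X ⟨true⟩
  let t : S := MvPolynomial.X ⟨false⟩
  let f : S →ₐ[k] S := MvPolynomial.aeval fun _ => t
  have hfX : ∀ i, f (MvPolynomial.X i) = t := fun i => MvPolynomial.aeval_X _ i
  have hf : ∀ x, f (f x) = f x := by
    intro x
    have : f.comp f = f := MvPolynomial.algHom_ext fun i => by
      rw [AlgHom.comp_apply, hfX]
      exact hfX _
    exact congrArg (fun h => h x) this
  let _ : CommTriAlgebra k S := ofIdempotent f hf
  obtain ⟨φ, ⟨hast, hbul, hφ⟩, -⟩ := hA S fun _ => s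
  obtain ⟨x₀⟩ := ‹Nonempty X›
  -- Repeated •-squaring: a_j is the 2^j-th •-power of a generator, so one generator suffices.
  let a (j : ℕ) : A := (fun y => bul (k := k) y y)^[j] (ι x₀)
  have ha : ∀ j, φ (a j) = s ^ 2 ^ j := by
    intro j
    induction j with
    | zero => simp [a, hφ]
    | succ j ih =>
      have : a (j + 1) = bul (k := k) (a j) (a j) := Function.iterate_succ_apply' _ _ _
      rw [this, hbul, ih, pow_succ, pow_mul, sq]
      rfl
  refine ⟨fun j => a j, LinearIndependent.of_comp φ ?_⟩
  have key : ∀ I : NESubset n, φ (monomialP k (fun j : Fin n => a j) I.1) =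
      s ^ (∑ j ∈ I.1, 2 ^ (j : ℕ)) * t ^ (∑ j ∈ I.1ᶜ, 2 ^ (j : ℕ)) := by
    intro I
    rw [map_monomialP (u := φ) (v := f.toLinearMap ∘ₗ φ) hbul hast
      (fun x y => by
        simp only [LinearMap.comp_apply, hast]
        change f (φ x * f (φ y)) = f (φ x) * f (φ y)
        rw [map_mul, hf]) _ I.2]
    have : ∀ j : Fin n, (if j ∈ I.1 then φ else f.toLinearMap ∘ₗ φ) (a j) =
        if j ∈ I.1 then s ^ 2 ^ (j : ℕ) else t ^ 2 ^ (j : ℕ) := by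
      intro j
      split_ifs
      · exact ha j
      · change f (φ (a j)) = _
        rw [ha, map_pow, hfX]
    simp only [this, Finset.prod_ite, Finset.prod_pow_eq_pow_sum]
    congr 2
    · congr 1
      simp
    · congr 1
      ext; simp
  have key' : ∀ I : NESubset n, φ (monomialP k (fun j : Fin n => a j) I.1) =
      MvPolynomial.monomial (Finsupp.single ⟨true⟩ (∑ j ∈ I.1, 2 ^ (j : ℕ)) +
        Finsupp.single ⟨false⟩ (∑ j ∈ I.1ᶜ, 2 ^ (j : ℕ))) (1 : k) := by
    intro I
    rw [key, MvPolynomial.X_pow_eq_monomial, MvPolynomial.X_pow_eq_monomial,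
      MvPolynomial.monomial_mul, one_mul]
  have hli := (MvPolynomial.basisMonomials σ k).linearIndependent.comp
    (fun I : NESubset n => Finsupp.single ⟨true⟩ (∑ j ∈ I.1, 2 ^ (j : ℕ)) +
        Finsupp.single ⟨false⟩ (∑ j ∈ I.1ᶜ, 2 ^ (j : ℕ))) (by
      intro I I' h
      have hne : (⟨false⟩ : σ) ≠ ⟨true⟩ := fun h => by cases h
      -- The exponent of s alone already determines I.
      have := congrArg (fun e => e ⟨true⟩) h
      exact Subtype.ext (Finset.sum_two_pow_injective n (by simpa [Finsupp.single_apply, hne] using this)))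
  have e : φ ∘ (fun I : NESubset n => monomialP k (fun j : Fin n => a j) I.1) =
      MvPolynomial.basisMonomials σ k ∘ fun I : NESubset n =>
        Finsupp.single ⟨true⟩ (∑ j ∈ I.1, 2 ^ (j : ℕ)) +
          Finsupp.single ⟨false⟩ (∑ j ∈ I.1ᶜ, 2 ^ (j : ℕ)) :=
    funext fun I => by simp [key']
  rw [e]
  exact hli

end CommTriAlgebra

/-- Over a field the family has coordinate functionals on all of V; applying the i-th to the left
tensor factor isolates y_i. -/
theorem LinearIndependent.eq_zero_of_sum_tmul_eq_zero {k V N κ : Type*} [Field k] [AddCommGroup V]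
    [Module k V] [AddCommGroup N] [Module k N] [Fintype κ] {m : κ → V} (hm : LinearIndependent k m)
    {y : κ → N} (h : ∑ i, m i ⊗ₜ[k] y i = 0) (i : κ) : y i = 0 := by
  classical
  obtain ⟨q, hq⟩ := LinearMap.exists_leftInverse_of_injective (Finsupp.linearCombination k m)
    (LinearMap.ker_eq_bot.2 hm)
  have hq' : ∀ j, q (m j) = Finsupp.single j 1 := fun j => by
    simpa using congrArg (fun f => f (Finsupp.single j 1)) hq
  have := congrArg (TensorProduct.lid k N ∘ (Finsupp.lapply i ∘ₗ q).rTensor N) h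
  simpa [hq', Finsupp.single_apply, ite_smul] using this

/-- A single tuple a is enough: b stays arbitrary, and independence separates the components g(I;
b). -/
theorem comparison_injective {k A B N : Type*} [Field k]
    [AddCommGroup A] [Module k A] [CommTriAlgebra k A] [AddCommGroup B] [Module k B]
    [AddCommGroup N] [Module k N] {n : ℕ} {a : Fin n → A}
    (ha : LinearIndependent k fun I : NESubset n => monomialP k a I.1) :
    Function.Injective (comparison k A B N n) := by
  rw [injective_iff_map_eq_zero]
  intro g hg
  funext I
  refine MultilinearMap.ext fun b => ?_
  have h := comparison_tmul g a b
  rw [hg, _root_.zero_apply] at h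
  exact (ha.eq_zero_of_sum_tmul_eq_zero h.symm) I

theorem theorem5p4 {k X A B N : Type*} [Field k] [Nonempty X]
    [AddCommGroup A] [Module k A] [CommTriAlgebra k A]
    (ι : X → A) (hA : CommTriAlgebra.IsFree k ι)
    [AddCommGroup B] [Module k B] [TriDendriform k B]
    [AddCommGroup N] [Module k N] [TriDendModule k B N] :
    -- `A ⊗ B` is an associative algebra
    (∀ x y z : A ⊗[k] B,
      tensorMul k A B (tensorMul k A B x y) z = tensorMul k A B x (tensorMul k A B y z)) ∧
    -- `A ⊗ N` is an `A ⊗ B`-bimodule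
    (∀ (x y : A ⊗[k] B) (m : A ⊗[k] N),
      tensorLeft k A B N (tensorMul k A B x y) m
        = tensorLeft k A B N x (tensorLeft k A B N y m) ∧
      tensorRight k A B N (tensorLeft k A B N x m) y
        = tensorLeft k A B N x (tensorRight k A B N m y) ∧
      tensorRight k A B N (tensorRight k A B N m x) y
        = tensorRight k A B N m (tensorMul k A B x y)) ∧
    -- both sequences of cochains are complexes
    (∀ n : ℕ, triD k B N (n + 1) ∘ₗ triD k B N n = 0) ∧
    (∀ n : ℕ, tensorHochD k A B N (n + 1) ∘ₗ tensorHochD k A B N n = 0) ∧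
    -- the map `Ψ`, determined by its values on elementary tensors
    ∃ Ψ : ∀ n : ℕ, TriCochain k B N n →ₗ[k] Cochain k (A ⊗[k] B) (A ⊗[k] N) n,
      (∀ (n : ℕ) (g : TriCochain k B N n) (a : Fin n → A) (b : Fin n → B),
        Ψ n g (fun i => a i ⊗ₜ[k] b i) = ∑ I : NESubset n, monomialP k a I.1 ⊗ₜ[k] g I b) ∧
      -- it is a cochain map
      (∀ (n : ℕ) (g : TriCochain k B N n),
        tensorHochD k A B N n (Ψ n g) = Ψ (n + 1) (triD k B N n g)) ∧
      -- it is injective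
      (∀ n : ℕ, Function.Injective (Ψ n)) ∧
      -- it sends cocycles to cocycles and coboundaries to coboundaries
      (∀ (n : ℕ) (g : TriCochain k B N n),
        triD k B N n g = 0 → tensorHochD k A B N n (Ψ n g) = 0) ∧
      (∀ (n : ℕ) (g : TriCochain k B N (n + 1)),
        g ∈ LinearMap.range (triD k B N n) →
          Ψ (n + 1) g ∈ LinearMap.range (tensorHochD k A B N n)) := by
  have hinj : ∀ n, Function.Injective (comparison k A B N n) := fun n =>
    comparison_injective (hA.exists_linearIndependent n).choose_spec
  have hsq : ∀ n : ℕ, tensorHochD k A B N (n + 1) ∘ₗ tensorHochD k A B N n = 0 := fun n =>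
    hochD_comp_hochD tensorMul_assoc tensorLeft_tensorMul
      (fun x y m => tensorRight_tensorLeft x y m) (fun x y m => tensorRight_tensorMul x y m) n
  refine ⟨tensorMul_assoc, fun x y m => ⟨tensorLeft_tensorMul x y m, tensorRight_tensorLeft x y m,
    tensorRight_tensorMul x y m⟩, fun n => LinearMap.ext fun g => hinj _ ?_, hsq,
    comparison k A B N, fun n g a b => comparison_tmul g a b, tensorHochD_comparison, hinj,
    fun n g hg => ?_, ?_⟩
  -- δ_tri² = 0: its image under the injective Ψ is δ_HH² applied to Ψg.
  · rw [LinearMap.comp_apply, ← tensorHochD_comparison, ← tensorHochD_comparison,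
      LinearMap.zero_apply, map_zero]
    exact congrArg (fun f => f (comparison k A B N n g)) (hsq n)
  · rw [tensorHochD_comparison, hg, map_zero]
  · rintro n _ ⟨g, rfl⟩
    exact ⟨comparison k A B N n g, tensorHochD_comparison n g⟩
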